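/- **Setting.** Fix a set $\mathit{dom}$ of non-fresh constants and a set $\Gamma_f$ of fresh constants, enumerated as a sequence; fresh constants come after all non-fresh ones. *Conceptual dependencies.* An EER schema $\mathcal C$ consists of finitely many entities, relationships (each among $n\ge 2$ entities $E_1,\dots,E_n$) and attributes (each of one entity or relationship), together with is-a links between entities, is-a links $R\to R'[j_1,\dots,j_n]$ between relationships of the same arity ($j$ a permutation), a choice of which attributes are mandatory and which are functional, and a choice of mandatory and functional participations of entities as $c$-th components of relationships in which they are the $c$-th entity. Its relational schema $\mathcal R$ has a unary predicate $e$ for each entity, an $n$-ary predicate $r$ for each $n$-ary relationship, and an $(n+1)$-ary predicate $a$ for each attribute of a concept with an $n$-ary predicate. The set $\Sigma$ of conceptual dependencies (CDs) of $\mathcal C$ consists of the inclusion dependencies (IDs) $a[1..n]\subseteq p[1..n]$ for each attribute $a$ of $p$; $p[1..n]\subseteq a[1..n]$ if $a$ is mandatory; $r[i]\subseteq e_i[1]$ for the $i$-th entity of $r$; $e[1]\subseteq e'[1]$ for each is-a between entities; $r[1..n]\subseteq r'[j_1,\dots,j_n]$ for each is-a between relationships; $e[1]\subseteq r[c]$ for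 each mandatory participation; and the key dependencies (KDs) $key(a)=\{1,\dots,n\}$ for each functional attribute and $key(r)=\{c\}$ for each functional participation. *Chase.* Let $D$ be a finite database over $\mathcal R$ with constants in $\mathit{dom}$. Fix total orders on facts and on dependencies, used only to break ties. The chase starts from $D$, all facts at level $0$, and repeats the following. (1) If two distinct facts of one relation agree on a key of it, take such a pair with the smallest minimum of the two levels (ties: first pair, then first KD) and identify their arguments position by position: two distinct non-fresh constants make the chase fail; otherwise the later of the two constants is replaced everywhere by the earlier one, non-fresh constants being earlier than fresh ones. Facts that become equal are collapsed and receive the minimum of their levels. (2) Otherwise, if some fact $r(t)$ violates an ID $r[X]\subseteq s[Y]$, take such a fact and ID, preferring full-width IDs (those in which all attributes of $r$ and of $s$ occur), then the lowest level of the fact, then the first fact, then the first ID; add a fact $s(t')$ with $t'[Y]=t[X]$ and new distinct fresh constants, later than all those used before, at the other positions. Its level is that of $r(t)$ plus $1$. The chase $chase(\Sigma,D)$ exists if this never fails; it is then the (possibly infinite) set of facts that are present from some step on, each with the level that it has from some step on. *Queries.* A conjunctive query $q$ over $\mathcal R$ has a head that is a finite sequence of distinct variables and a body that is a finite set of atoms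 with variables and constants of $\mathit{dom}$ as arguments; every head variable occurs in the body. A homomorphism maps variables to constants and fixes $\mathit{dom}$. An answer to $q$ over a set $B$ of facts is a tuple $t$ for which some homomorphism sends the body of $q$ to facts of $B$ and the head to $t$; it is fresh-free if all its entries are in $\mathit{dom}$. The join graph of $D$ has the atoms of $D$ as nodes, two distinct atoms being adjacent iff they share a constant; $\gamma(D)$ denotes the number of atoms of its largest connected component ($0$ if $D=\emptyset$). **Theorem.** Let $\Sigma$ be the set of CDs of an EER schema with relational schema $\mathcal R$, and let $q$ be a conjunctive query over $\mathcal R$. There is a function $\delta_M:\mathbb N\to\mathbb N$, depending only on $\mathcal R$, $\Sigma$ and $q$, such that for every finite database $D$ over $\mathcal R$ with constants in $\mathit{dom}$ for which $chase(\Sigma,D)$ exists (whatever the tie-breaking orders), and for every fresh-free answer $t$ to $q$ over $chase(\Sigma,D)$, there is a homomorphism $\mu$ that sends the head of $q$ to $t$ and the body of $q$ to facts of $chase(\Sigma,D)$, all of which have level at most $\delta_M(\gamma(D))$. -/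

import Mathlib

/-! ### Relational schemata, constants, atoms -/

/-- A relational schema: predicate symbols with arities. -/
structure RelSchema where
  Pred : Type*
  arity : Pred → ℕ

/-- Constants: non-fresh ones (from `Dom`) and fresh ones. The order in which fresh constants
follow one another is the order of `ℕ`; every fresh constant follows every non-fresh one. -/
inductive Const (Dom : Type*) where
  | dom (c : Dom)
  | fresh (k : ℕ)

/-- Atoms over a schema `R` with arguments in `α`; attributes are numbered from `0`. -/
@[ext]
structure Atom (R : RelSchema) (α : Type*) where
  pred : R.Pred
  args : Fin (R.arity pred) → α

/-- Apply a map to all the arguments of an atom. -/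
def Atom.map {R : RelSchema} {α β : Type*} (f : α → β) (A : Atom R α) : Atom R β :=
  ⟨A.pred, fun i => f (A.args i)⟩

/-- Facts: atoms whose arguments are (fresh or non-fresh) constants. -/
abbrev DBFact (R : RelSchema) (Dom : Type*) := Atom R (Const Dom)

/-! ### Dependencies -/

/-- An inclusion dependency `src[X] ⊆ tgt[Y]`, where `X` and `Y` are sequences of `width`
distinct attributes. -/
structure InclDep (R : RelSchema) where
  src : R.Pred
  tgt : R.Pred
  width : ℕ
  X : Fin width ↪ Fin (R.arity src)
  Y : Fin width ↪ Fin (R.arity tgt)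

/-- Every attribute of either predicate occurs (exactly once). -/
def InclDep.FullWidth {R : RelSchema} (σ : InclDep R) : Prop :=
  Function.Surjective σ.X ∧ Function.Surjective σ.Y

/-- A key dependency `key(pred) = key`. -/
structure KeyDep (R : RelSchema) where
  pred : R.Pred
  key : Finset (Fin (R.arity pred))
  two_le_arity : 2 ≤ R.arity pred
  key_nonempty : key.Nonempty

/-- A set of inclusion and key dependencies. -/
structure Deps (R : RelSchema) where
  ids : Set (InclDep R)
  kds : Set (KeyDep R)

/-! ### Extended entity-relationship schemata and conceptual dependencies -/

/-- An EER schema: finitely many entity, relationship and attribute symbols with their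
definitions. -/
structure EERSchema.{u} where
  Ent : Type u
  Rel : Type u
  Att : Type u
  finite_ent : Finite Ent
  finite_rel : Finite Rel
  finite_att : Finite Att
  /-- `entIsa E E'`: the definition of `E` lists `E'` in its is-a clause. -/
  entIsa : Ent → Ent → Prop
  /-- Arity of a relationship. -/
  relArity : Rel → ℕ
  two_le_relArity : ∀ R, 2 ≤ relArity R
  /-- The entities among which a relationship is defined. -/
  among : (R : Rel) → Fin (relArity R) → Ent
  /-- `relIsa R R' j`: the definition of `R` lists `R'[j₁,…,jₙ]` in its is-a clause. -/
  relIsa : (R R' : Rel) → (Fin (relArity R) ≃ Fin (relArity R')) → Prop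
  /-- Participation with minimum cardinality 1 of an entity as a component of a relationship. -/
  mandatoryPart : Ent → (R : Rel) → Fin (relArity R) → Prop
  /-- Participation with maximum cardinality 1 of an entity as a component of a relationship. -/
  functionalPart : Ent → (R : Rel) → Fin (relArity R) → Prop
  mandatoryPart_among : ∀ E R c, mandatoryPart E R c → among R c = E
  functionalPart_among : ∀ E R c, functionalPart E R c → among R c = E
  /-- The entity or relationship an attribute belongs to. -/
  owner : Att → Ent ⊕ Rel
  /-- The attributes qualified as functional. -/
  functionalAtt : Att → Prop
  /-- The attributes qualified as mandatory. -/
  mandatoryAtt : Att → Prop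

namespace EERSchema

/-- Predicates of the associated relational schema: one for each entity or relationship, and one
for each attribute. -/
inductive PredSym (C : EERSchema) where
  | concept (X : C.Ent ⊕ C.Rel)
  | att (A : C.Att)

/-- Entities have arity `1`, relationships their own arity. -/
def conceptArity (C : EERSchema) : C.Ent ⊕ C.Rel → ℕ
  | .inl _ => 1
  | .inr R => C.relArity R

/-- An attribute of a concept of arity `n` has arity `n + 1`. -/
def predArity (C : EERSchema) : C.PredSym → ℕ
  | .concept X => C.conceptArity X
  | .att A => C.conceptArity (C.owner A) + 1

/-- The relational schema associated with an EER schema. -/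
def relSchema (C : EERSchema) : RelSchema := ⟨C.PredSym, C.predArity⟩

def ent (C : EERSchema) (E : C.Ent) : C.relSchema.Pred := PredSym.concept (.inl E)

def rel (C : EERSchema) (R : C.Rel) : C.relSchema.Pred := PredSym.concept (.inr R)

def att (C : EERSchema) (A : C.Att) : C.relSchema.Pred := PredSym.att A

/-- The predicate of the concept that owns an attribute. -/
def ownerPred (C : EERSchema) (A : C.Att) : C.relSchema.Pred := PredSym.concept (C.owner A)

theorem conceptArity_pos (C : EERSchema) (X : C.Ent ⊕ C.Rel) : 0 < C.conceptArity X := by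
  cases X with
  | inl E => exact Nat.one_pos
  | inr R => exact lt_of_lt_of_le Nat.two_pos (C.two_le_relArity R)

/-- The sequence consisting of the single attribute `i`. -/
def single {n : ℕ} (i : Fin n) : Fin 1 ↪ Fin n := ⟨fun _ => i, fun _ _ _ => Subsingleton.elim _ _⟩

/-- `e[1]`, for a unary predicate `e`. -/
def entAttr (C : EERSchema) (E : C.Ent) : Fin 1 ↪ Fin (C.relSchema.arity (C.ent E)) :=
  Function.Embedding.refl (Fin 1)

/-- `r[i]`, for a relationship predicate `r`. -/
def relAttr (C : EERSchema) (R : C.Rel) (i : Fin (C.relArity R)) :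
    Fin 1 ↪ Fin (C.relSchema.arity (C.rel R)) := single (n := C.relArity R) i

/-- `a[1,…,n]`, for an attribute predicate `a` of arity `n + 1`. -/
def attAttrs (C : EERSchema) (A : C.Att) :
    Fin (C.conceptArity (C.owner A)) ↪ Fin (C.relSchema.arity (C.att A)) := Fin.castSuccEmb

/-- `p[1,…,n]`, for the predicate `p` of arity `n` that owns the attribute `A`. -/
def ownerAttrs (C : EERSchema) (A : C.Att) :
    Fin (C.conceptArity (C.owner A)) ↪ Fin (C.relSchema.arity (C.ownerPred A)) :=
  Function.Embedding.refl (Fin (C.conceptArity (C.owner A)))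

/-- The inclusion dependencies imposed by an EER schema. -/
inductive IsID (C : EERSchema) : InclDep C.relSchema → Prop
  /-- `a[1,…,n] ⊆ p[1,…,n]` for an attribute `a` of the entity or relationship `p`. -/
  | attOwner (A : C.Att) :
      IsID C ⟨C.att A, C.ownerPred A, _, C.attAttrs A, C.ownerAttrs A⟩
  /-- `r[i] ⊆ eᵢ[1]` for a relationship among `e₁,…,eₙ`. -/
  | component (R : C.Rel) (i : Fin (C.relArity R)) :
      IsID C ⟨C.rel R, C.ent (C.among R i), 1, C.relAttr R i, C.entAttr (C.among R i)⟩
  /-- `p[1,…,n] ⊆ a[1,…,n]` for a mandatory attribute `a` of `p`. -/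
  | attMandatory (A : C.Att) (h : C.mandatoryAtt A) :
      IsID C ⟨C.ownerPred A, C.att A, _, C.ownerAttrs A, C.attAttrs A⟩
  /-- `e[1] ⊆ e'[1]` for an is-a between entities. -/
  | entIsa (E E' : C.Ent) (h : C.entIsa E E') :
      IsID C ⟨C.ent E, C.ent E', 1, C.entAttr E, C.entAttr E'⟩
  /-- `r[1,…,n] ⊆ r'[j₁,…,jₙ]` for an is-a between relationships. -/
  | relIsa (R R' : C.Rel) (j : Fin (C.relArity R) ≃ Fin (C.relArity R')) (h : C.relIsa R R' j) :
      IsID C ⟨C.rel R, C.rel R', C.relArity R,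
        Function.Embedding.refl (Fin (C.relArity R)), j.toEmbedding⟩
  /-- `e[1] ⊆ r[c]` for a mandatory participation. -/
  | partMandatory (E : C.Ent) (R : C.Rel) (c : Fin (C.relArity R)) (h : C.mandatoryPart E R c) :
      IsID C ⟨C.ent E, C.rel R, 1, C.entAttr E, C.relAttr R c⟩

/-- `key(a) = {1,…,n}`, for an attribute predicate of arity `n + 1`. -/
def attKey (C : EERSchema) (A : C.Att) : KeyDep C.relSchema where
  pred := C.att A
  key := Finset.univ.map (C.attAttrs A)
  two_le_arity := Nat.succ_le_succ (C.conceptArity_pos (C.owner A))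
  key_nonempty := (Finset.univ_nonempty_iff.2 ⟨⟨0, C.conceptArity_pos (C.owner A)⟩⟩).map

/-- `key(r) = {c}`, for a relationship predicate. -/
def relKey (C : EERSchema) (R : C.Rel) (c : Fin (C.relArity R)) : KeyDep C.relSchema where
  pred := C.rel R
  key := ({c} : Finset (Fin (C.relArity R)))
  two_le_arity := C.two_le_relArity R
  key_nonempty := Finset.singleton_nonempty c

/-- The key dependencies imposed by an EER schema. -/
inductive IsKD (C : EERSchema) : KeyDep C.relSchema → Prop
  /-- Functional attributes. -/
  | attFunctional (A : C.Att) (h : C.functionalAtt A) : IsKD C (C.attKey A)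
  /-- Participations with maximum cardinality 1. -/
  | partFunctional (E : C.Ent) (R : C.Rel) (c : Fin (C.relArity R))
      (h : C.functionalPart E R c) : IsKD C (C.relKey R c)

/-- The conceptual dependencies of an EER schema. -/
def cds (C : EERSchema) : Deps C.relSchema := ⟨{σ | C.IsID σ}, {κ | C.IsKD κ}⟩

end EERSchema

/-! ### The chase -/

/-- A stage of the chase construction: the current facts, their levels, and the first fresh
constant that has not been used so far. -/
structure ChaseState (R : RelSchema) (Dom : Type*) where
  facts : Set (DBFact R Dom)
  level : DBFact R Dom → ℕ
  next : ℕ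

namespace Chase

open scoped Classical

variable {R : RelSchema} {Dom : Type*}

/-- The initial stage: the facts of the database, all at level `0`. -/
def init (D : Finset (Atom R Dom)) : ChaseState R Dom where
  facts := Atom.map Const.dom '' (D : Set (Atom R Dom))
  level := fun _ => 0
  next := 0

/-- The combined symbol of two constants; `none` for two distinct non-fresh constants. -/
noncomputable def combine : Const Dom → Const Dom → Option (Const Dom)
  | .dom c, .dom d => if c = d then some (.dom c) else none
  | .dom c, .fresh _ => some (.dom c)
  | .fresh _, .dom d => some (.dom d)
  | .fresh k, .fresh l => some (.fresh (min k l))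

/-- Extend the replacement `θ` made so far by merging (the current values of) `a` and `b`. -/
noncomputable def merge (θ : Const Dom → Const Dom) (a b : Const Dom) :
    Option (Const Dom → Const Dom) :=
  (combine (θ a) (θ b)).map fun c x => if θ x = θ a ∨ θ x = θ b then c else θ x

/-- Two tuples of the relation of a key dependency. -/
structure KDTrigger (R : RelSchema) (Dom : Type*) where
  kd : KeyDep R
  fst : Fin (R.arity kd.pred) → Const Dom
  snd : Fin (R.arity kd.pred) → Const Dom

namespace KDTrigger

def fstFact (τ : KDTrigger R Dom) : DBFact R Dom := ⟨τ.kd.pred, τ.fst⟩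

def sndFact (τ : KDTrigger R Dom) : DBFact R Dom := ⟨τ.kd.pred, τ.snd⟩

/-- The two tuples are distinct tuples of the current stage that agree on the key. -/
def Applicable (S : Deps R) (I : ChaseState R Dom) (τ : KDTrigger R Dom) : Prop :=
  τ.kd ∈ S.kds ∧ τ.fstFact ∈ I.facts ∧ τ.sndFact ∈ I.facts ∧ τ.fst ≠ τ.snd ∧
    ∀ i ∈ τ.kd.key, τ.fst i = τ.snd i

/-- The replacement of symbols that makes the two tuples equal, obtained by merging the symbols
at the non-key attributes one after the other; `none` if two distinct non-fresh constants would
have to be merged. -/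
noncomputable def unifier (τ : KDTrigger R Dom) : Option (Const Dom → Const Dom) :=
  ((List.finRange (R.arity τ.kd.pred)).filter (· ∉ τ.kd.key)).foldlM
    (fun θ i => merge θ (τ.fst i) (τ.snd i)) id

/-- The key dependency chase rule; `none` if it fails. Facts that become equal collapse to one
fact, whose level is the minimum of theirs. -/
noncomputable def apply (τ : KDTrigger R Dom) (I : ChaseState R Dom) :
    Option (ChaseState R Dom) :=
  τ.unifier.map fun θ =>
    { facts := Atom.map θ '' I.facts
      level := fun f => sInf {l | ∃ g ∈ I.facts, g.map θ = f ∧ I.level g = l}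
      next := I.next }

variable [LinearOrder (DBFact R Dom)] [LinearOrder (KeyDep R)]

/-- Priority of a trigger: first by the minimum of the two levels, then by the order of the pairs
of facts, then by the order of the key dependencies. -/
def rank (I : ChaseState R Dom) (τ : KDTrigger R Dom) :
    ℕ ×ₗ DBFact R Dom ×ₗ DBFact R Dom ×ₗ KeyDep R :=
  toLex (min (I.level τ.fstFact) (I.level τ.sndFact),
    toLex (τ.fstFact, toLex (τ.sndFact, τ.kd)))

/-- The applicable trigger that comes first. -/
def IsFirst (S : Deps R) (I : ChaseState R Dom) (τ : KDTrigger R Dom) : Prop :=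
  τ.Applicable S I ∧ ∀ τ' : KDTrigger R Dom, τ'.Applicable S I → τ.rank I ≤ τ'.rank I

end KDTrigger

/-- An inclusion dependency and a tuple of its left-hand relation. -/
structure IDTrigger (R : RelSchema) (Dom : Type*) where
  dep : InclDep R
  tup : Fin (R.arity dep.src) → Const Dom

namespace IDTrigger

def fact (τ : IDTrigger R Dom) : DBFact R Dom := ⟨τ.dep.src, τ.tup⟩

/-- The tuple is in the current stage and violates the inclusion dependency. -/
def Applicable (S : Deps R) (I : ChaseState R Dom) (τ : IDTrigger R Dom) : Prop :=
  τ.dep ∈ S.ids ∧ τ.fact ∈ I.facts ∧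
    ¬ ∃ t' : Fin (R.arity τ.dep.tgt) → Const Dom,
      (⟨τ.dep.tgt, t'⟩ : DBFact R Dom) ∈ I.facts ∧ ∀ i, t' (τ.dep.Y i) = τ.tup (τ.dep.X i)

/-- The new fact: it agrees with the given tuple as the dependency demands, and has pairwise
distinct fresh constants, following all those used so far, at the other attributes. -/
noncomputable def newFact (τ : IDTrigger R Dom) (I : ChaseState R Dom) : DBFact R Dom :=
  ⟨τ.dep.tgt, fun j =>
    if h : ∃ i, τ.dep.Y i = j then τ.tup (τ.dep.X h.choose) else .fresh (I.next + j)⟩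

/-- The inclusion dependency chase rule. -/
noncomputable def apply (τ : IDTrigger R Dom) (I : ChaseState R Dom) : ChaseState R Dom where
  facts := insert (τ.newFact I) I.facts
  level := Function.update I.level (τ.newFact I) (I.level τ.fact + 1)
  next := I.next + R.arity τ.dep.tgt

variable [LinearOrder (DBFact R Dom)] [LinearOrder (InclDep R)]

/-- Priority of a trigger: full-width dependencies first, then by the level of the fact, then by
the order of the facts, then by the order of the inclusion dependencies. -/
noncomputable def rank (I : ChaseState R Dom) (τ : IDTrigger R Dom) :
    ℕ ×ₗ ℕ ×ₗ DBFact R Dom ×ₗ InclDep R :=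
  toLex (if τ.dep.FullWidth then 0 else 1, toLex (I.level τ.fact, toLex (τ.fact, τ.dep)))

/-- The applicable trigger that comes first. -/
def IsFirst (S : Deps R) (I : ChaseState R Dom) (τ : IDTrigger R Dom) : Prop :=
  τ.Applicable S I ∧ ∀ τ' : IDTrigger R Dom, τ'.Applicable S I → τ.rank I ≤ τ'.rank I

end IDTrigger

variable [LinearOrder (DBFact R Dom)] [LinearOrder (InclDep R)] [LinearOrder (KeyDep R)]

/-- One chase step: the key dependency rule if it is applicable, otherwise the inclusion
dependency rule if it is applicable, otherwise nothing; `none` stands for failure. -/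
noncomputable def step (S : Deps R) (I : ChaseState R Dom) : Option (ChaseState R Dom) :=
  if h : ∃ τ : KDTrigger R Dom, τ.IsFirst S I then h.choose.apply I
  else if h : ∃ τ : IDTrigger R Dom, τ.IsFirst S I then some (h.choose.apply I)
  else some I

/-- The stages of the chase of `D`; `none` from the moment of failure on. -/
noncomputable def stage (S : Deps R) (D : Finset (Atom R Dom)) : ℕ → Option (ChaseState R Dom)
  | 0 => some (init D)
  | n + 1 => (stage S D n).bind (step S)

/-- The chase exists if its construction never fails. -/
def Exists (S : Deps R) (D : Finset (Atom R Dom)) : Prop := ∀ n, (stage S D n).isSome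

/-- The (possibly infinite) chase: the facts that belong to all stages from some stage on. -/
def chase (S : Deps R) (D : Finset (Atom R Dom)) : Set (DBFact R Dom) :=
  {f | ∀ᶠ n in Filter.atTop, ∃ I, stage S D n = some I ∧ f ∈ I.facts}

/-- `f` is a fact of the chase, and its level (the one it has from some stage on) is `l`. -/
def HasLevel (S : Deps R) (D : Finset (Atom R Dom)) (f : DBFact R Dom) (l : ℕ) : Prop :=
  ∀ᶠ n in Filter.atTop, ∃ I, stage S D n = some I ∧ f ∈ I.facts ∧ I.level f = l

/-- The facts of the chase whose level is at most `m`. -/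
def firstLevels (S : Deps R) (D : Finset (Atom R Dom)) (m : ℕ) : Set (DBFact R Dom) :=
  {f | ∃ l ≤ m, HasLevel S D f l}

end Chase

/-! ### The join graph -/

/-- The join graph of a database: two distinct atoms are adjacent iff they share a constant. -/
def joinGraph {R : RelSchema} {Dom : Type*} (D : Finset (Atom R Dom)) :
    SimpleGraph {A : Atom R Dom // A ∈ D} where
  Adj A B := A ≠ B ∧ ∃ i j, A.1.args i = B.1.args j
  symm := ⟨fun _ _ h => ⟨h.1.symm, let ⟨i, j, e⟩ := h.2; ⟨j, i, e.symm⟩⟩⟩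
  loopless := ⟨fun _ h => h.1 rfl⟩

/-- The number of atoms of a largest connected component of the join graph (`0` if the database
is empty). -/
noncomputable def largestComponent {R : RelSchema} {Dom : Type*} (D : Finset (Atom R Dom)) : ℕ :=
  ⨆ K : (joinGraph D).ConnectedComponent, K.supp.ncard

/-! ### Conjunctive queries -/

/-- Terms of a query: variables and non-fresh constants. -/
inductive Term (Dom Var : Type*) where
  | const (c : Dom)
  | var (x : Var)

/-- The value of a term under a mapping of the variables; non-fresh constants are fixed. -/
def Term.value {Dom Var : Type*} (μ : Var → Const Dom) : Term Dom Var → Const Dom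
  | .const c => .dom c
  | .var x => μ x

/-- A conjunctive query: the head is a sequence of distinct variables, each of which occurs in
the body. -/
structure ConjQuery (R : RelSchema) (Dom Var : Type*) where
  arity : ℕ
  head : Fin arity → Var
  body : Finset (Atom R (Term Dom Var))
  head_injective : Function.Injective head
  rangeRestricted : ∀ i, ∃ A ∈ body, ∃ j, A.args j = .var (head i)

namespace ConjQuery

variable {R : RelSchema} {Dom Var : Type*}

/-- `μ` is a homomorphism that sends the body of `q` to facts in `B` and the head to `t`. -/
def IsWitness (q : ConjQuery R Dom Var) (B : Set (DBFact R Dom)) (t : Fin q.arity → Const Dom)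
    (μ : Var → Const Dom) : Prop :=
  (∀ A ∈ q.body, A.map (Term.value μ) ∈ B) ∧ ∀ i, μ (q.head i) = t i

/-- The answers to `q` over a database. -/
def answers (q : ConjQuery R Dom Var) (B : Set (DBFact R Dom)) : Set (Fin q.arity → Const Dom) :=
  {t | ∃ μ, q.IsWitness B t μ}

/-- The answers that contain no fresh constants. -/
def freshFreeAnswers (q : ConjQuery R Dom Var) (B : Set (DBFact R Dom)) :
    Set (Fin q.arity → Const Dom) :=
  {t | t ∈ q.answers B ∧ ∀ i, ∃ c, t i = .dom c}

end ConjQuery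

/-! The chase never mixes connected components. Keys are nonempty and inclusion dependencies have
positive width, so two facts merged by a step share a constant, and so do a new fact and its source.
Color the constants by the components of the join graph and let new constants inherit the color of
the fact that creates them (`Run.exists_coloring`). Then every fact is monochromatic, the facts of
one color grow out of at most `γ(D)` atoms, and steps in other colors leave them alone.

Levels are controlled color by color. Dependencies that are not of full width are applied at the
lowest violated level. Hence, while the lowest violation in a color has level `v`, every step in
that color lowers a `potential` built from the numbers of violations, constants and absent facts. So
all facts of that color have a level bounded in terms of `v` and `γ(D)` (`Run.exists_level_bound`).
A dependency on a fact of level `m` is therefore satisfied by a fact of level at most `levelBound m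
+ 1` (`Run.exists_witness_level_le`). This survives in the limit of the run, which is a model of all
dependencies (`Run.low_kd`, `Run.low_id`).

A homomorphism into this limit can thus be extended along the steps of any other run, restricted to
chosen colors. The levels of the images depend only on the number of steps and on the component size
(`Run.exists_transfer`).

It remains to bound the number of steps. A match of the query touches at most `|body|` colors, hence
at most `|body| * γ(D)` atoms of `D`. Up to renaming of constants, these atoms, the answer and the
constants of the query form one of finitely many patterns. Fix one run and one stage for each
pattern that ever occurs with a match. Every other match with that pattern can be replaced by the
image of the fixed one, and the maximum of the finitely many transfer bounds serves as `δM`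
(`exists_bound`). Conceptual dependencies enter through `Deps.Tame`. -/

namespace Atom

/-! ### Mapping the arguments of atoms -/

variable {R : RelSchema} {α β γ : Type*}

theorem map_map (f : α → β) (g : β → γ) (A : Atom R α) : (A.map f).map g = A.map (g ∘ f) := rfl

theorem map_congr {f g : α → β} {A : Atom R α} (h : ∀ i, f (A.args i) = g (A.args i)) :
    A.map f = A.map g := by
  simp only [Atom.map, h]

theorem map_eq_self {f : α → α} {A : Atom R α} (h : ∀ i, f (A.args i) = A.args i) :
    A.map f = A := by
  simp only [Atom.map, h]

theorem args_eq_of_map_eq_self {f : α → α} {A : Atom R α} (h : A.map f = A)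
    (i : Fin (R.arity A.pred)) : f (A.args i) = A.args i := by
  obtain ⟨p, t⟩ := A
  simp only [Atom.map, Atom.mk.injEq, heq_eq_eq, true_and] at h
  exact congrFun h i

theorem map_injective {f : α → β} (hf : Function.Injective f) :
    Function.Injective (Atom.map (R := R) f) := by
  rintro ⟨p, s⟩ ⟨p', s'⟩ h
  simp only [Atom.map, Atom.mk.injEq] at h
  obtain ⟨rfl, h⟩ := h
  simp only [heq_eq_eq] at h
  congr 1
  exact funext fun i => hf (congrFun h i)

/-- Atoms are the same as pairs of a predicate and a tuple of arguments. -/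
def equivSigma (R : RelSchema) (α : Type*) : Atom R α ≃ Σ p : R.Pred, (Fin (R.arity p) → α) where
  toFun A := ⟨A.pred, A.args⟩
  invFun A := ⟨A.1, A.2⟩
  left_inv _ := rfl
  right_inv _ := rfl

end Atom

namespace Chase

variable {R : RelSchema} {Dom : Type*}

/-! ### The unifier of a key dependency step -/

/-- The position of a constant in the order of replacement. -/
def weight : Const Dom → ℕ
  | .dom _ => 0
  | .fresh k => k + 1

theorem combine_spec {u v c : Const Dom} (h : combine u v = some c) :
    (c = u ∨ c = v) ∧ weight c ≤ weight u ∧ weight c ≤ weight v ∧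
      (∀ d, u = .dom d → c = .dom d) ∧ ∀ d, v = .dom d → c = .dom d := by
  cases u with
  | dom a =>
    cases v with
    | dom b =>
      simp only [combine] at h
      split_ifs at h with hab
      subst hab
      cases h
      simp
    | fresh l =>
      cases h
      simp [weight]
  | fresh k =>
    cases v with
    | dom b =>
      cases h
      simp [weight]
    | fresh l =>
      cases h
      rcases le_total k l with hkl | hkl <;> simp [weight, hkl]

/-- The replacements reached from the identity by merging constants, among them the constants of
the pairs in `P`. -/
structure IsUnifier (P : Set (Const Dom × Const Dom)) (θ : Const Dom → Const Dom) : Prop where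
  unifies : ∀ p ∈ P, θ p.1 = θ p.2
  rel : ∀ s : Setoid (Const Dom), (∀ p ∈ P, s p.1 p.2) → ∀ x, s (θ x) x
  dom : ∀ d, θ (.dom d) = .dom d
  weight_le : ∀ x, weight (θ x) ≤ weight x

/-- Every map that unifies the pairs factors through the replacement. -/
theorem IsUnifier.factor {κ : Type*} {P : Set (Const Dom × Const Dom)}
    {θ : Const Dom → Const Dom} (hθ : IsUnifier P θ) (h : Const Dom → κ)
    (hP : ∀ p ∈ P, h p.1 = h p.2) (x : Const Dom) : h (θ x) = h x :=
  hθ.rel (Setoid.ker h) hP x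

theorem isUnifier_id : IsUnifier (∅ : Set (Const Dom × Const Dom)) id :=
  ⟨by simp, fun s _ x => s.refl x, fun _ => rfl, fun _ => le_rfl⟩

theorem IsUnifier.merge {P : Set (Const Dom × Const Dom)} {θ θ' : Const Dom → Const Dom}
    (hθ : IsUnifier P θ) {a b : Const Dom} (h : merge θ a b = some θ') :
    IsUnifier (insert (a, b) P) θ' := by
  simp only [Chase.merge, Option.map_eq_some_iff] at h
  obtain ⟨c, hc, rfl⟩ := h
  obtain ⟨hmem, hwa, hwb, hda, hdb⟩ := combine_spec hc
  refine ⟨?_, ?_, ?_, ?_⟩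
  · rintro p (rfl | hp)
    · simp
    · have e := hθ.unifies p hp
      by_cases hor : θ p.2 = θ a ∨ θ p.2 = θ b
      · rw [if_pos hor, if_pos (by rwa [e])]
      · rw [if_neg hor, if_neg (by rwa [e]), e]
  · intro s hP x
    have hx := hθ.rel s (fun p hp => hP p (Set.mem_insert_of_mem _ hp))
    have hab : s a b := hP (a, b) (Set.mem_insert _ _)
    have hca : s c a := by
      rcases hmem with rfl | rfl
      · exact hx a
      · exact s.trans (hx b) (s.symm hab)
    split_ifs with hor
    · rcases hor with e | e
      · exact s.trans hca (s.trans (s.symm (hx a)) (e ▸ hx x))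
      · exact s.trans hca (s.trans hab (s.trans (s.symm (hx b)) (e ▸ hx x)))
    · exact hx x
  · intro d
    split_ifs with hor
    · rcases hor with e | e
      · exact hda d (by rw [← e, hθ.dom])
      · exact hdb d (by rw [← e, hθ.dom])
    · exact hθ.dom d
  · intro x
    split_ifs with hor
    · rcases hor with e | e
      · exact (hwa.trans_eq (by rw [e])).trans (hθ.weight_le x)
      · exact (hwb.trans_eq (by rw [e])).trans (hθ.weight_le x)
    · exact hθ.weight_le x

theorem IsUnifier.foldlM {ι : Type*} (f g : ι → Const Dom) (l : List ι)
    {P : Set (Const Dom × Const Dom)} {θ θ' : Const Dom → Const Dom} (hθ : IsUnifier P θ)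
    (h : l.foldlM (fun θ i => Chase.merge θ (f i) (g i)) θ = some θ') :
    IsUnifier (P ∪ {p | ∃ i ∈ l, p = (f i, g i)}) θ' := by
  induction l generalizing P θ with
  | nil =>
    simp only [List.foldlM_nil] at h
    cases h
    simpa using hθ
  | cons i l ih =>
    simp only [List.foldlM_cons] at h
    obtain ⟨θ₁, h₁, h₂⟩ := Option.bind_eq_some_iff.1 h
    convert ih (hθ.merge h₁) h₂ using 1
    ext p
    simp only [Set.mem_union, Set.mem_insert_iff, Set.mem_ofPred_eq, List.mem_cons]
    constructor
    · rintro (h | ⟨j, rfl | hj, rfl⟩)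
      · exact .inl (.inr h)
      · exact .inl (.inl rfl)
      · exact .inr ⟨j, hj, rfl⟩
    · rintro ((rfl | h) | ⟨j, hj, rfl⟩)
      · exact .inr ⟨i, .inl rfl, rfl⟩
      · exact .inl h
      · exact .inr ⟨j, .inr hj, rfl⟩

namespace KDTrigger

/-- The pairs of constants that the key dependency rule identifies. -/
def pairs (τ : KDTrigger R Dom) : Set (Const Dom × Const Dom) :=
  {p | ∃ i, p = (τ.fst i, τ.snd i)}

/-- The fold visits only non-key positions; at key positions the two tuples agree already. -/
theorem isUnifier {S : Deps R} {I : ChaseState R Dom} {τ : KDTrigger R Dom}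
    (hτ : τ.Applicable S I) {θ : Const Dom → Const Dom} (h : τ.unifier = some θ) :
    IsUnifier τ.pairs θ := by
  have h' := isUnifier_id.foldlM τ.fst τ.snd _ h
  have hkey := hτ.2.2.2.2
  refine ⟨?_, ?_, h'.dom, h'.weight_le⟩
  · rintro p ⟨i, rfl⟩
    by_cases hi : i ∈ τ.kd.key
    · simp only [hkey i hi]
    · exact h'.unifies _ (.inr ⟨i, by simp [hi], rfl⟩)
  · intro s hs x
    refine h'.rel s ?_ x
    rintro p (hp | ⟨i, -, rfl⟩)
    · exact hp.elim
    · exact hs _ ⟨i, rfl⟩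

end KDTrigger

namespace IsUnifier

variable {P : Set (Const Dom × Const Dom)} {θ : Const Dom → Const Dom}

/-- `θ` itself unifies the pairs, so it factors through `θ`. -/
theorem idem (hθ : IsUnifier P θ) (x : Const Dom) : θ (θ x) = θ x :=
  hθ.factor θ hθ.unifies x

/-- Weight determines a fresh constant, so a proper replacement is strictly earlier. This makes the
successive replacements of a constant stabilize. -/
theorem eq_or_weight_lt (hθ : IsUnifier P θ) (x : Const Dom) :
    θ x = x ∨ weight (θ x) < weight x := by
  cases x with
  | dom d => exact .inl (hθ.dom d)
  | fresh k =>
    rcases (hθ.weight_le (.fresh k)).eq_or_lt with h | h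
    · left
      cases hx : θ (.fresh k) with
      | dom d => simp [hx, weight] at h
      | fresh l =>
        simp only [hx, weight, Nat.add_right_cancel_iff] at h
        rw [h]
    · exact .inr h

end IsUnifier

/-- The indicator function of `x` unifies all pairs, hence is preserved by `θ`. -/
theorem IsUnifier.eq_self {P : Set (Const Dom × Const Dom)} {θ : Const Dom → Const Dom}
    (hθ : IsUnifier P θ) {x : Const Dom} (hx : ∀ p ∈ P, x ≠ p.1 ∧ x ≠ p.2) : θ x = x := by
  classical
  have := hθ.factor (fun y => y = x) (fun p hp => by
    simp [(hx p hp).1.symm, (hx p hp).2.symm]) x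
  simpa using this

end Chase

/-- The finiteness and non-degeneracy conditions under which the chase is analysed. -/
structure Deps.Tame {R : RelSchema} (S : Deps R) : Prop where
  finite_pred : Finite R.Pred
  arity_pos : ∀ p, 0 < R.arity p
  finite_ids : S.ids.Finite
  finite_kds : S.kds.Finite
  width_pos : ∀ σ ∈ S.ids, 0 < σ.width

namespace Chase

variable {R : RelSchema} {Dom : Type*} {S : Deps R}

/-! ### New facts -/

namespace IDTrigger

theorem newFact_args_Y (τ : IDTrigger R Dom) (I : ChaseState R Dom) (i : Fin τ.dep.width) :
    (τ.newFact I).args (τ.dep.Y i) = τ.tup (τ.dep.X i) := by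
  have h : ∃ i', τ.dep.Y i' = τ.dep.Y i := ⟨i, rfl⟩
  simp only [newFact, dif_pos h]
  rw [τ.dep.Y.injective h.choose_spec]

theorem newFact_args_of_notMem (τ : IDTrigger R Dom) (I : ChaseState R Dom)
    {j : Fin (R.arity τ.dep.tgt)} (h : ¬ ∃ i, τ.dep.Y i = j) :
    (τ.newFact I).args j = .fresh (I.next + j) := by
  simp only [newFact, dif_neg h]

theorem newFact_notMem {I : ChaseState R Dom} {τ : IDTrigger R Dom} (h : τ.Applicable S I) :
    τ.newFact I ∉ I.facts :=
  fun hmem => h.2.2 ⟨(τ.newFact I).args, hmem, τ.newFact_args_Y I⟩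

end IDTrigger

/-! ### Single steps -/

/-- `Next S I θ J`: a chase step leads from `I` to `J` and replaces constants according to `θ`.
Only that part of the order of rule applications is recorded that does not depend on how ties
are broken. -/
inductive Next (S : Deps R) (I : ChaseState R Dom) :
    (Const Dom → Const Dom) → ChaseState R Dom → Prop
  | kd (τ : KDTrigger R Dom) (θ : Const Dom → Const Dom) (J : ChaseState R Dom)
      (happ : τ.Applicable S I) (hθ : IsUnifier τ.pairs θ)
      (hfacts : J.facts = Atom.map θ '' I.facts)
      (hlevel : ∀ f, J.level f = sInf {l | ∃ g ∈ I.facts, g.map θ = f ∧ I.level g = l})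
      (hnext : J.next = I.next) : Next S I θ J
  | id (τ : IDTrigger R Dom) (hkd : ∀ τ' : KDTrigger R Dom, ¬ τ'.Applicable S I)
      (happ : τ.Applicable S I)
      (hmin : ¬ τ.dep.FullWidth → ∀ τ' : IDTrigger R Dom, τ'.Applicable S I →
        I.level τ.fact ≤ I.level τ'.fact) : Next S I id (τ.apply I)
  | idle (hkd : ∀ τ' : KDTrigger R Dom, ¬ τ'.Applicable S I)
      (hid : ∀ τ' : IDTrigger R Dom, ¬ τ'.Applicable S I) : Next S I id I

theorem level_apply_newFact (τ : IDTrigger R Dom) (I : ChaseState R Dom) :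
    (τ.apply I).level (τ.newFact I) = I.level τ.fact + 1 := by
  simp [IDTrigger.apply]

theorem level_apply_of_mem {I : ChaseState R Dom} {τ : IDTrigger R Dom} (h : τ.Applicable S I)
    {f : DBFact R Dom} (hf : f ∈ I.facts) : (τ.apply I).level f = I.level f := by
  have : f ≠ τ.newFact I := fun e => IDTrigger.newFact_notMem h (e ▸ hf)
  simp [IDTrigger.apply, this]

theorem exists_preimage_of_kd {I J : ChaseState R Dom} {θ : Const Dom → Const Dom}
    (hfacts : J.facts = Atom.map θ '' I.facts)
    (hlevel : ∀ f, J.level f = sInf {l | ∃ g ∈ I.facts, g.map θ = f ∧ I.level g = l})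
    {g : DBFact R Dom} (hg : g ∈ J.facts) :
    ∃ f ∈ I.facts, f.map θ = g ∧ I.level f = J.level g := by
  rw [hfacts] at hg
  obtain ⟨f, hf, rfl⟩ := hg
  have := Nat.sInf_mem (s := {l | ∃ g ∈ I.facts, g.map θ = f.map θ ∧ I.level g = l})
    ⟨_, f, hf, rfl, rfl⟩
  rw [← hlevel] at this
  exact this

namespace Next

variable {I J : ChaseState R Dom} {θ : Const Dom → Const Dom}

theorem map_mem (h : Next S I θ J) {f : DBFact R Dom} (hf : f ∈ I.facts) : f.map θ ∈ J.facts := by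
  cases h with
  | kd τ _ _ _ _ hfacts => exact hfacts ▸ ⟨f, hf, rfl⟩
  | id τ _ happ => exact Set.mem_insert_of_mem _ hf
  | idle => exact hf

theorem level_map_le (h : Next S I θ J) {f : DBFact R Dom} (hf : f ∈ I.facts) :
    J.level (f.map θ) ≤ I.level f := by
  cases h with
  | kd τ _ _ _ _ _ hlevel => exact hlevel _ ▸ Nat.sInf_le ⟨f, hf, rfl, rfl⟩
  | id τ _ happ => exact (level_apply_of_mem happ hf).le
  | idle => exact le_rfl

/-- A fact after a step is the image of a fact of the same level, or the new fact. -/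
theorem origin (h : Next S I θ J) {g : DBFact R Dom} (hg : g ∈ J.facts) :
    (∃ f ∈ I.facts, f.map θ = g ∧ I.level f = J.level g) ∨
      ∃ τ : IDTrigger R Dom, τ.Applicable S I ∧ θ = _root_.id ∧ J = τ.apply I ∧
        g = τ.newFact I ∧ J.level g = I.level τ.fact + 1 := by
  cases h with
  | kd τ _ _ _ _ hfacts hlevel =>
    exact .inl (exists_preimage_of_kd hfacts hlevel hg)
  | id τ _ happ =>
    rcases hg with rfl | hg
    · exact .inr ⟨τ, happ, rfl, rfl, rfl, level_apply_newFact τ I⟩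
    · exact .inl ⟨g, hg, rfl, (level_apply_of_mem happ hg).symm⟩
  | idle => exact .inl ⟨g, hg, rfl, rfl⟩

theorem dom (h : Next S I θ J) (d : Dom) : θ (.dom d) = .dom d := by
  cases h with
  | kd τ _ _ _ hθ => exact hθ.dom d
  | _ => rfl

theorem eq_or_weight_lt (h : Next S I θ J) (x : Const Dom) :
    θ x = x ∨ weight (θ x) < weight x := by
  cases h with
  | kd τ _ _ _ hθ => exact hθ.eq_or_weight_lt x
  | _ => exact .inl rfl

/-- By idempotence, the constants present after a step are not among those it replaces. -/
theorem map_eq_self (h : Next S I θ J) {f : DBFact R Dom} (hf : f ∈ J.facts) : f.map θ = f := by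
  cases h with
  | kd τ _ _ _ hθ hfacts =>
    rw [hfacts] at hf
    obtain ⟨g, hg, rfl⟩ := hf
    exact Atom.map_eq_self fun i => hθ.idem _
  | _ => rfl

theorem next_le (h : Next S I θ J) : I.next ≤ J.next := by
  cases h with
  | kd τ _ _ _ _ _ _ hnext => exact hnext.ge
  | id τ => exact Nat.le_add_right _ _
  | idle => exact le_rfl

theorem finite_facts (h : Next S I θ J) (hI : I.facts.Finite) : J.facts.Finite := by
  cases h with
  | kd τ _ _ _ _ hfacts => exact hfacts ▸ hI.image _
  | id τ => exact hI.insert _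
  | idle => exact hI

end Next

/-- The constants that are not to be used as new fresh constants. -/
def Old (m : ℕ) : Const Dom → Prop
  | .dom _ => True
  | .fresh k => k < m

theorem Old.mono {m n : ℕ} (h : m ≤ n) : ∀ {x : Const Dom}, Old m x → Old n x
  | .dom _, _ => trivial
  | .fresh _, hx => lt_of_lt_of_le hx h

theorem old_iff_weight_le {m : ℕ} {x : Const Dom} : Old m x ↔ weight x ≤ m := by
  cases x <;> simp [Old, weight]

theorem Next.weight_le {I J : ChaseState R Dom} {θ : Const Dom → Const Dom} (h : Next S I θ J)
    (x : Const Dom) : weight (θ x) ≤ weight x := by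
  rcases h.eq_or_weight_lt x with e | e
  · rw [e]
  · exact e.le

theorem Next.old {I J : ChaseState R Dom} {θ : Const Dom → Const Dom} (h : Next S I θ J)
    (hI : ∀ f ∈ I.facts, ∀ i, Old I.next (f.args i)) :
    ∀ f ∈ J.facts, ∀ i, Old J.next (f.args i) := by
  intro g hg
  rcases h.origin hg with ⟨f, hf, rfl, -⟩ | ⟨τ, happ, -, rfl, rfl, -⟩
  · intro i
    exact (old_iff_weight_le.2 ((h.weight_le _).trans (old_iff_weight_le.1 (hI f hf i)))).mono
      h.next_le
  · intro j
    by_cases hj : ∃ i, τ.dep.Y i = j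
    · obtain ⟨i, rfl⟩ := hj
      rw [τ.newFact_args_Y]
      exact (hI _ happ.2.1 _).mono h.next_le
    · rw [τ.newFact_args_of_notMem I hj]
      exact Nat.add_lt_add_left j.2 _

/-! ### Runs -/

/-- An infinite sequence of chase steps from the database `D`. -/
structure Run (S : Deps R) (D : Finset (Atom R Dom)) where
  state : ℕ → ChaseState R Dom
  subst : ℕ → Const Dom → Const Dom
  state_zero : state 0 = init D
  next : ∀ n, Next S (state n) (subst n) (state (n + 1))

namespace Run

variable {D : Finset (Atom R Dom)} (r : Run S D)

theorem finite_facts (n : ℕ) : (r.state n).facts.Finite := by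
  induction n with
  | zero =>
    rw [r.state_zero]
    exact D.finite_toSet.image _
  | succ n ih => exact (r.next n).finite_facts ih

theorem old (n : ℕ) : ∀ f ∈ (r.state n).facts, ∀ i, Old (r.state n).next (f.args i) := by
  induction n with
  | zero =>
    rw [r.state_zero]
    rintro _ ⟨A, -, rfl⟩ i
    trivial
  | succ n ih => exact (r.next n).old ih

end Run

/-- Finitely many facts and dependencies give finitely many triggers, so an applicable trigger
implies a first one. -/
theorem exists_run_step [LinearOrder (DBFact R Dom)] [LinearOrder (InclDep R)]
    [LinearOrder (KeyDep R)] (hS : S.Tame) {I J : ChaseState R Dom} (hI : I.facts.Finite)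
    (h : step S I = some J) : ∃ θ, Next S I θ J := by
  classical
  have hkd : ¬ (∃ τ : KDTrigger R Dom, τ.IsFirst S I) →
      ∀ τ : KDTrigger R Dom, ¬ τ.Applicable S I := by
    intro hno τ hτ
    have hfin : {τ : KDTrigger R Dom | τ.Applicable S I}.Finite := by
      refine Set.Finite.of_injOn (f := fun τ : KDTrigger R Dom => (τ.kd, τ.fstFact, τ.sndFact))
        (t := S.kds ×ˢ I.facts ×ˢ I.facts) ?_ ?_ (hS.finite_kds.prod (hI.prod hI))
      · exact fun τ hτ => ⟨hτ.1, hτ.2.1, hτ.2.2.1⟩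
      · rintro ⟨k, s, t⟩ - ⟨k', s', t'⟩ - he
        simp only [Prod.mk.injEq] at he
        obtain ⟨rfl, h₁, h₂⟩ := he
        simp only [KDTrigger.fstFact, KDTrigger.sndFact, Atom.mk.injEq, heq_eq_eq,
          true_and] at h₁ h₂
        rw [h₁, h₂]
    obtain ⟨τ₀, h₀, hmin⟩ := Set.exists_min_image _ (fun τ => τ.rank I) hfin ⟨τ, hτ⟩
    exact hno ⟨τ₀, h₀, hmin⟩
  have hid : ¬ (∃ τ : IDTrigger R Dom, τ.IsFirst S I) →
      ∀ τ : IDTrigger R Dom, ¬ τ.Applicable S I := by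
    intro hno τ hτ
    have hfin : {τ : IDTrigger R Dom | τ.Applicable S I}.Finite := by
      refine Set.Finite.of_injOn (f := fun τ : IDTrigger R Dom => (τ.dep, τ.fact))
        (t := S.ids ×ˢ I.facts) ?_ ?_ (hS.finite_ids.prod hI)
      · exact fun τ hτ => ⟨hτ.1, hτ.2.1⟩
      · rintro ⟨k, s⟩ - ⟨k', s'⟩ - he
        simp only [Prod.mk.injEq] at he
        obtain ⟨rfl, h₁⟩ := he
        simp only [IDTrigger.fact, Atom.mk.injEq, heq_eq_eq, true_and] at h₁
        rw [h₁]
    obtain ⟨τ₀, h₀, hmin⟩ := Set.exists_min_image _ (fun τ => τ.rank I) hfin ⟨τ, hτ⟩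
    exact hno ⟨τ₀, h₀, hmin⟩
  unfold step at h
  split_ifs at h with h₁ h₂
  · have happ := h₁.choose_spec.1
    rw [KDTrigger.apply, Option.map_eq_some_iff] at h
    obtain ⟨θ, hu, rfl⟩ := h
    exact ⟨θ, .kd _ θ _ happ (KDTrigger.isUnifier happ hu) rfl (fun _ => rfl) rfl⟩
  · cases h
    refine ⟨id, .id _ (hkd h₁) h₂.choose_spec.1 fun hfull τ' hτ' => ?_⟩
    have hle := h₂.choose_spec.2 τ' hτ'
    simp only [IDTrigger.rank, if_neg hfull, Prod.Lex.toLex_le_toLex] at hle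
    -- The first rank entry of the chosen trigger is `1`, the largest possible, so the comparison is
    -- decided by the levels.
    rcases hle with hlt | ⟨-, hlt | ⟨heq, -⟩⟩
    · split_ifs at hlt <;> omega
    · exact hlt.le
    · exact heq.le
  · cases h
    exact ⟨id, .idle (hkd h₁) (hid h₂)⟩

theorem Exists.run [LinearOrder (DBFact R Dom)] [LinearOrder (InclDep R)]
    [LinearOrder (KeyDep R)] (hS : S.Tame) {D : Finset (Atom R Dom)} (h : Exists S D) :
    ∃ r : Run S D, ∀ n, stage S D n = some (r.state n) := by
  choose I hI using fun n => Option.isSome_iff_exists.1 (h n)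
  have hI0 : I 0 = init D := (Option.some_injective _ (hI 0)).symm
  have hstep : ∀ n, step S (I n) = some (I (n + 1)) := by
    intro n
    have := hI (n + 1)
    rwa [stage, hI n, Option.bind_some] at this
  have hfin : ∀ n, (I n).facts.Finite := by
    intro n
    induction n with
    | zero =>
      rw [hI0]
      exact D.finite_toSet.image _
    | succ n ih =>
      obtain ⟨θ, hθ⟩ := exists_run_step hS ih (hstep n)
      exact hθ.finite_facts ih
  choose θ hθ using fun n => exists_run_step hS (hfin n) (hstep n)
  exact ⟨⟨I, θ, hI0, hθ⟩, hI⟩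

end Chase

namespace Chase

variable {R : RelSchema} {Dom κ : Type*} {S : Deps R} {D : Finset (Atom R Dom)}

/-! ### Colorings of the constants -/

/-- All arguments of each fact have the same color. -/
def Monochromatic (B : Set (DBFact R Dom)) (col : Const Dom → κ) : Prop :=
  ∀ f ∈ B, ∀ i j, col (f.args i) = col (f.args j)

/-- The tuples share a constant because the key is nonempty. -/
theorem KDTrigger.Applicable.color_eq {I : ChaseState R Dom} {τ : KDTrigger R Dom}
    (hτ : τ.Applicable S I) {col : Const Dom → κ} (hcol : Monochromatic I.facts col)
    (i j : Fin (R.arity τ.kd.pred)) : col (τ.fst i) = col (τ.snd j) := by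
  obtain ⟨l, hl⟩ := τ.kd.key_nonempty
  have h₁ : col (τ.fst i) = col (τ.fst l) := hcol _ hτ.2.1 i l
  have h₂ : col (τ.snd l) = col (τ.snd j) := hcol _ hτ.2.2.1 l j
  rw [h₁, hτ.2.2.2.2 l hl, h₂]

/-- By `color_eq` the coloring unifies the merged pairs, hence factors through the replacement. -/
theorem Next.color_subst {I J : ChaseState R Dom} {θ : Const Dom → Const Dom}
    (h : Next S I θ J) {col : Const Dom → κ} (hcol : Monochromatic I.facts col) (x : Const Dom) :
    col (θ x) = col x := by
  cases h with
  | kd τ _ _ happ hθ =>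
    refine hθ.factor col ?_ x
    rintro _ ⟨i, rfl⟩
    exact happ.color_eq hcol i i
  | _ => rfl

/-- Constants that are not yet old have no binding color; they receive that of the fact to which the
inclusion dependency is applied. -/
theorem Next.exists_color (hS : S.Tame) {I J : ChaseState R Dom} {θ : Const Dom → Const Dom}
    (h : Next S I θ J) (hold : ∀ f ∈ I.facts, ∀ i, Old I.next (f.args i))
    {col : Const Dom → κ} (hcol : Monochromatic I.facts col) :
    ∃ col' : Const Dom → κ, Monochromatic J.facts col' ∧ ∀ x, Old I.next x → col' x = col x := by
  classical
  by_cases hnew : ∃ τ : IDTrigger R Dom, τ.Applicable S I ∧ J = τ.apply I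
  · obtain ⟨τ, happ, rfl⟩ := hnew
    have hw := hS.width_pos _ happ.1
    refine ⟨fun x => if Old I.next x then col x else col (τ.tup (τ.dep.X ⟨0, hw⟩)), ?_,
      fun x hx => if_pos hx⟩
    rintro f (rfl | hf)
    · have key : ∀ j, (if Old I.next ((τ.newFact I).args j) then col ((τ.newFact I).args j)
          else col (τ.tup (τ.dep.X ⟨0, hw⟩))) = col (τ.tup (τ.dep.X ⟨0, hw⟩)) := by
        intro j
        by_cases hj : ∃ i, τ.dep.Y i = j
        · obtain ⟨i, rfl⟩ := hj
          rw [τ.newFact_args_Y]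
          split_ifs with ho
          · exact hcol _ happ.2.1 _ _
          · rfl
        · rw [τ.newFact_args_of_notMem I hj, if_neg]
          simp [Old]
      intro i j
      exact (key i).trans (key j).symm
    · intro i j
      simp only [if_pos (hold f hf i), if_pos (hold f hf j)]
      exact hcol f hf i j
  · refine ⟨col, ?_, fun _ _ => rfl⟩
    intro g hg
    rcases h.origin hg with ⟨f, hf, rfl, -⟩ | ⟨τ, happ, -, hJ, -⟩
    · intro i j
      exact (h.color_subst hcol _).trans ((hcol f hf i j).trans (h.color_subst hcol _).symm)
    · exact (hnew ⟨τ, happ, hJ⟩).elim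

namespace Run

/-- A coloring of the constants for which all facts of all stages are monochromatic. -/
def IsColoring (r : Run S D) (col : Const Dom → κ) : Prop :=
  ∀ n, Monochromatic (r.state n).facts col

theorem next_mono (r : Run S D) : Monotone fun n => (r.state n).next :=
  monotone_nat_of_le_succ fun n => (r.next n).next_le

theorem exists_coloring (hS : S.Tame) (r : Run S D) (col₀ : Const Dom → κ)
    (hD : ∀ A ∈ D, ∀ i j, col₀ (.dom (A.args i)) = col₀ (.dom (A.args j))) :
    ∃ col : Const Dom → κ, (∀ c, col (.dom c) = col₀ (.dom c)) ∧ r.IsColoring col := by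
  classical
  have hex : ∀ n (c : {c : Const Dom → κ // Monochromatic (r.state n).facts c}),
      ∃ c' : {c : Const Dom → κ // Monochromatic (r.state (n + 1)).facts c},
        ∀ x, Old (r.state n).next x → c'.1 x = c.1 x := by
    intro n c
    obtain ⟨c', h₁, h₂⟩ := (r.next n).exists_color hS (r.old n) c.2
    exact ⟨⟨c', h₁⟩, h₂⟩
  choose F hF using hex
  have h₀ : Monochromatic (r.state 0).facts col₀ := by
    rw [r.state_zero]
    rintro _ ⟨A, hA, rfl⟩ i j
    exact hD A hA i j
  let s : ∀ n, {c : Const Dom → κ // Monochromatic (r.state n).facts c} :=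
    fun n => Nat.rec ⟨col₀, h₀⟩ F n
  have hs : ∀ n x, Old (r.state n).next x → ∀ m, n ≤ m → (s m).1 x = (s n).1 x := by
    intro n x hx m hm
    induction m, hm using Nat.le_induction with
    | base => rfl
    | succ m hm ih => exact (hF m (s m) x (hx.mono (r.next_mono hm))).trans ih
  -- The color of a constant is settled at the first stage where it is old; constants that never
  -- become old keep an arbitrary one.
  have hlim : ∀ x, ∃ k, ∀ n, Old (r.state n).next x → (s n).1 x = k := by
    intro x
    by_cases hx : ∃ n, Old (r.state n).next x
    · refine ⟨(s (Nat.find hx)).1 x, fun n hn => ?_⟩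
      exact hs _ _ (Nat.find_spec hx) _ (Nat.find_min' hx hn)
    · exact ⟨col₀ x, fun n hn => (hx ⟨n, hn⟩).elim⟩
  choose col hcol using hlim
  refine ⟨col, fun c => (hcol (.dom c) 0 trivial).symm, fun n f hf i j => ?_⟩
  rw [← hcol _ n (r.old n f hf i), ← hcol _ n (r.old n f hf j)]
  exact (s n).2 f hf i j

variable {r : Run S D} {col : Const Dom → κ}

theorem IsColoring.color_subst (h : r.IsColoring col) (n : ℕ) (x : Const Dom) :
    col (r.subst n x) = col x :=
  (r.next n).color_subst (h n) x

end Run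

/-- Positive width makes the new fact share a constant with its source. -/
theorem color_newFact (hS : S.Tame) {I : ChaseState R Dom} {τ : IDTrigger R Dom}
    (happ : τ.Applicable S I) {col : Const Dom → κ}
    (hcol : Monochromatic (τ.apply I).facts col) (i : Fin (R.arity τ.dep.src))
    (j : Fin (R.arity τ.dep.tgt)) : col ((τ.newFact I).args j) = col (τ.tup i) := by
  have hw := hS.width_pos _ happ.1
  have h₁ := hcol _ (Set.mem_insert _ _) j (τ.dep.Y ⟨0, hw⟩)
  rw [τ.newFact_args_Y] at h₁
  exact h₁.trans (hcol _ (Set.mem_insert_of_mem _ happ.2.1) _ i)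

end Chase

namespace Chase

variable {R : RelSchema} {Dom κ : Type*} {S : Deps R} {D : Finset (Atom R Dom)}

/-! ### A numerical bound on the number of steps -/

/-- The number of atoms over `c` constants. -/
noncomputable def atomCount (R : RelSchema) (c : ℕ) : ℕ := Nat.card (Atom R (Fin c))

instance {α : Type*} [Finite R.Pred] [Finite α] : Finite (Atom R α) :=
  Finite.of_equiv _ (Atom.equivSigma R α).symm

theorem atomCount_mono [Finite R.Pred] : Monotone (atomCount R) := fun _ _ h =>
  Nat.card_le_card_of_injective _ (Atom.map_injective (Fin.castLE_injective h))

/-- The atoms all of whose arguments lie in `X`. -/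
def atomsOver (R : RelSchema) {α : Type*} (X : Set α) : Set (Atom R α) := {f | ∀ i, f.args i ∈ X}

theorem atomsOver_eq_range {α : Type*} (X : Set α) :
    atomsOver R X = Set.range (Atom.map (R := R) (Subtype.val : X → α)) := by
  ext f
  constructor
  · intro h
    exact ⟨⟨f.pred, fun i => ⟨f.args i, h i⟩⟩, rfl⟩
  · rintro ⟨g, rfl⟩ i
    exact (g.args i).2

theorem finite_atomsOver [Finite R.Pred] {α : Type*} {X : Set α} (hX : X.Finite) :
    (atomsOver R X).Finite := by
  have := hX.to_subtype
  rw [atomsOver_eq_range]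
  exact Set.finite_range _

theorem ncard_atomsOver_le [Finite R.Pred] {α : Type*} {X : Set α} (hX : X.Finite) :
    (atomsOver R X).ncard ≤ atomCount R X.ncard := by
  have := hX.to_subtype
  have e : X ≃ Fin X.ncard := Finite.equivFinOfCardEq rfl
  rw [atomsOver_eq_range, ← Nat.card_coe_set_eq]
  refine (Nat.card_le_card_of_surjective _ Set.rangeFactorization_surjective).trans ?_
  exact Nat.card_le_card_of_injective _ (Atom.map_injective e.injective)

/-- A bound on the number of steps that can be made with `c` constants and `a` absent facts,
if no new constants are introduced. -/
def quietBound (Q : ℕ → ℕ) (c a : ℕ) : ℕ := a + ∑ i ∈ Finset.range c, (Q i + 1)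

/-- A bound on the number of steps that can be made with `c` constants and `a` absent facts,
if at most `W` new constants are introduced at most `u` times. -/
def stepBound (Q : ℕ → ℕ) (W : ℕ) : ℕ → ℕ → ℕ → ℕ
  | 0, c, a => quietBound Q c a
  | u + 1, c, a => quietBound Q c a + 1 + stepBound Q W u (c + W) (Q (c + W))

theorem quietBound_mono (Q : ℕ → ℕ) {c c' a a' : ℕ} (hc : c ≤ c') (ha : a ≤ a') :
    quietBound Q c a ≤ quietBound Q c' a' :=
  add_le_add ha (Finset.sum_le_sum_of_subset (Finset.range_mono hc))

/-- The summand `Q c' + 1` pays for the merge and for resetting the number of absent facts to at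
most `Q c'`. -/
theorem quietBound_lt (Q : ℕ → ℕ) {c c' a a' : ℕ} (hc : c' < c) (ha : a' ≤ Q c') :
    quietBound Q c' a' < quietBound Q c a := by
  refine lt_of_lt_of_le ?_ (quietBound_mono Q (Nat.succ_le_of_lt hc) (Nat.zero_le a))
  simp only [quietBound, Finset.sum_range_succ]
  omega

theorem stepBound_mono_right {Q : ℕ → ℕ} (hQ : Monotone Q) (W : ℕ)
    (u : ℕ) {c c' a a' : ℕ} (hc : c ≤ c') (ha : a ≤ a') :
    stepBound Q W u c a ≤ stepBound Q W u c' a' := by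
  induction u generalizing c c' a a' with
  | zero => exact quietBound_mono Q hc ha
  | succ u ih =>
    have h₁ := quietBound_mono Q hc ha
    have h₂ := ih (Nat.add_le_add_right hc W) (hQ (Nat.add_le_add_right hc W))
    simp only [stepBound]
    omega

/-- Unfolding one more violation replaces `a` by `Q (c + W)`, which explains the hypothesis `a ≤ Q
c`. -/
theorem stepBound_mono_left {Q : ℕ → ℕ} (hQ : Monotone Q) (W : ℕ)
    {u u' : ℕ} (hu : u ≤ u') {c a : ℕ} (ha : a ≤ Q c) :
    stepBound Q W u c a ≤ stepBound Q W u' c a := by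
  induction u', hu using Nat.le_induction with
  | base => exact le_rfl
  | succ n _ ih =>
    have := stepBound_mono_right hQ W n (Nat.le_add_right c W)
      (ha.trans (hQ (Nat.le_add_right c W)))
    simp only [stepBound]
    omega

/-- Serves for full-width inclusion dependencies, which add a fact over the constants at hand. -/
theorem stepBound_lt_of_absent_lt {Q : ℕ → ℕ} (hQ : Monotone Q) (W : ℕ)
    {u u' c a a' : ℕ} (hu : u' ≤ u) (ha' : a' < a) (ha : a ≤ Q c) :
    stepBound Q W u' c a' < stepBound Q W u c a := by
  refine (stepBound_mono_left hQ W hu (ha'.le.trans ha)).trans_lt ?_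
  cases u <;> simp only [stepBound, quietBound] <;> omega

/-- Serves for key dependencies: constants are lost, while the number of absent facts may grow. -/
theorem stepBound_lt_of_consts_lt {Q : ℕ → ℕ} (hQ : Monotone Q) (W : ℕ)
    {u u' c c' a a' : ℕ} (hu : u' ≤ u) (hc : c' < c)
    (ha : a' ≤ Q c') : stepBound Q W u' c' a' < stepBound Q W u c a := by
  refine (stepBound_mono_left hQ W hu ha).trans_lt ?_
  have h₁ := quietBound_lt Q (a := a) hc ha
  cases u with
  | zero => exact h₁
  | succ u =>
    have h₂ := stepBound_mono_right hQ W u (Nat.add_le_add_right hc.le W)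
      (hQ (Nat.add_le_add_right hc.le W))
    simp only [stepBound]
    omega

/-- Serves for the other inclusion dependencies: a violation is repaired at the price of at most `W`
new constants. -/
theorem stepBound_lt_of_violations_lt {Q : ℕ → ℕ} (hQ : Monotone Q) (W : ℕ)
    {u u' c c' a a' : ℕ} (hu : u' < u) (hc : c' ≤ c + W)
    (ha : a' ≤ Q c') : stepBound Q W u' c' a' < stepBound Q W u c a := by
  obtain ⟨u, rfl⟩ : ∃ w, u = w + 1 := ⟨u - 1, by omega⟩
  have h₁ := stepBound_mono_left hQ W (Nat.lt_succ_iff.1 hu) ha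
  have h₂ := stepBound_mono_right hQ W u hc (ha.trans (hQ hc))
  simp only [stepBound]
  omega

/-! ### The facts of one color -/

/-- The facts of color `k`. -/
def part (I : ChaseState R Dom) (col : Const Dom → κ) (k : κ) : Set (DBFact R Dom) :=
  {f | f ∈ I.facts ∧ ∀ i, col (f.args i) = k}

/-- The constants that occur in a set of facts. -/
def consts {α : Type*} (B : Set (Atom R α)) : Set α := {x | ∃ f ∈ B, ∃ i, f.args i = x}

/-- The facts that could be added without new constants. -/
def absent {α : Type*} (B : Set (Atom R α)) : Set (Atom R α) := atomsOver R (consts B) \ B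

/-- The violations of inclusion dependencies of level at most `v` by facts of color `k`. -/
def violations (S : Deps R) (I : ChaseState R Dom) (col : Const Dom → κ) (k : κ) (v : ℕ) :
    Set (IDTrigger R Dom) :=
  {τ | τ.Applicable S I ∧ (∀ i, col (τ.tup i) = k) ∧ I.level τ.fact ≤ v}

theorem finite_consts {α : Type*} {B : Set (Atom R α)} (hB : B.Finite) : (consts B).Finite := by
  have : consts B = ⋃ f ∈ B, Set.range f.args := by
    ext x
    simp [consts]
  rw [this]
  exact hB.biUnion fun f _ => Set.finite_range _

theorem subset_atomsOver_consts {α : Type*} (B : Set (Atom R α)) : B ⊆ atomsOver R (consts B) :=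
  fun f hf i => ⟨f, hf, i, rfl⟩

theorem ncard_absent_le [Finite R.Pred] {α : Type*} {B : Set (Atom R α)} (hB : B.Finite) :
    (absent B).ncard ≤ atomCount R (consts B).ncard :=
  (Set.ncard_le_ncard Set.sdiff_subset (finite_atomsOver (finite_consts hB))).trans
    (ncard_atomsOver_le (finite_consts hB))

theorem IDTrigger.eq_of_dep_of_fact {τ τ' : IDTrigger R Dom} (h₁ : τ.dep = τ'.dep)
    (h₂ : τ.fact = τ'.fact) : τ = τ' := by
  obtain ⟨d, t⟩ := τ
  obtain ⟨d', t'⟩ := τ'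
  obtain rfl : d = d' := h₁
  simp only [IDTrigger.fact, Atom.mk.injEq, heq_eq_eq, true_and] at h₂
  rw [h₂]

variable {I J : ChaseState R Dom} {θ : Const Dom → Const Dom} {col : Const Dom → κ} {k : κ}

theorem finite_part (hI : I.facts.Finite) : (part I col k).Finite := hI.subset fun _ h => h.1

theorem violations_mapsTo (v : ℕ) :
    Set.MapsTo (fun τ : IDTrigger R Dom => (τ.dep, τ.fact)) (violations S I col k v)
      (S.ids ×ˢ part I col k) :=
  fun _ hτ => ⟨hτ.1.1, hτ.1.2.1, hτ.2.1⟩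

theorem trigger_injective :
    Function.Injective fun τ : IDTrigger R Dom => (τ.dep, τ.fact) :=
  fun _ _ h => IDTrigger.eq_of_dep_of_fact (congrArg Prod.fst h) (congrArg Prod.snd h)

theorem finite_violations (hS : S.Tame) (hI : I.facts.Finite) (v : ℕ) :
    (violations S I col k v).Finite :=
  Set.Finite.of_injOn (violations_mapsTo v) trigger_injective.injOn
    (hS.finite_ids.prod (finite_part hI))

theorem ncard_violations_le (hS : S.Tame) (hI : I.facts.Finite) (v : ℕ) :
    (violations S I col k v).ncard ≤
      S.ids.ncard * atomCount R (consts (part I col k)).ncard := by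
  have := hS.finite_pred
  have hfin : (part I col k).Finite := finite_part hI
  refine (Set.ncard_le_ncard_of_injOn _ (violations_mapsTo v) trigger_injective.injOn
    (hS.finite_ids.prod hfin)).trans ?_
  rw [Set.ncard_prod]
  refine Nat.mul_le_mul_left _ ?_
  exact (Set.ncard_le_ncard (subset_atomsOver_consts _)
    (finite_atomsOver (finite_consts hfin))).trans (ncard_atomsOver_le (finite_consts hfin))

/-- A violation after a step comes from a violation of the same level before the step, or from
the new fact. -/
theorem Next.violation_origin (h : Next S I θ J) {τ : IDTrigger R Dom}
    (hτ : τ.Applicable S J) :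
    (∃ τ' : IDTrigger R Dom, τ'.Applicable S I ∧ τ'.dep = τ.dep ∧ τ'.fact.map θ = τ.fact ∧
      I.level τ'.fact = J.level τ.fact) ∨
    ∃ τ' : IDTrigger R Dom, τ'.Applicable S I ∧ J = τ'.apply I ∧ τ.fact = τ'.newFact I ∧
      J.level τ.fact = I.level τ'.fact + 1 := by
  rcases h.origin hτ.2.1 with ⟨⟨p, t⟩, hf, he, hl⟩ | ⟨τ', happ, -, hJ, he, hl⟩
  · left
    obtain ⟨d, s⟩ := τ
    have he' := he
    simp only [Atom.map, IDTrigger.fact, Atom.mk.injEq] at he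
    obtain ⟨rfl, he⟩ := he
    simp only [heq_eq_eq] at he
    subst he
    refine ⟨⟨d, t⟩, ⟨hτ.1, hf, ?_⟩, rfl, he', hl⟩
    rintro ⟨t', ht', hm⟩
    exact hτ.2.2 ⟨fun i => θ (t' i), h.map_mem ht', fun i => congrArg θ (hm i)⟩
  · exact .inr ⟨τ', happ, hJ, he, hl⟩

theorem color_tup_of_map_eq (hθ : ∀ x, col (θ x) = col x) {τ τ' : IDTrigger R Dom}
    (hd : τ'.dep = τ.dep) (hf : τ'.fact.map θ = τ.fact) (hk : ∀ i, col (τ.tup i) = k) :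
    ∀ i, col (τ'.tup i) = k := by
  obtain ⟨d, t⟩ := τ
  obtain ⟨d', t'⟩ := τ'
  obtain rfl : d' = d := hd
  simp only [IDTrigger.fact, Atom.map, Atom.mk.injEq, heq_eq_eq, true_and] at hf
  subst hf
  intro i
  rw [← hk i, hθ]

/-- Once repaired, low violations never reappear: a violation by the new fact has a parent violation
one level below it, in the same color. -/
theorem Next.violations_nonempty (hS : S.Tame) (h : Next S I θ J)
    (hI : Monochromatic I.facts col) (hJ : Monochromatic J.facts col) {v : ℕ}
    (hv : (violations S J col k v).Nonempty) : (violations S I col k v).Nonempty := by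
  obtain ⟨τ, hτ, hk, hl⟩ := hv
  rcases h.violation_origin hτ with ⟨τ', h₁, h₂, h₃, h₄⟩ | ⟨τ', h₁, rfl, h₃, h₄⟩
  · exact ⟨τ', h₁, color_tup_of_map_eq (h.color_subst hI) h₂ h₃ hk, h₄.le.trans hl⟩
  · refine ⟨τ', h₁, fun i => ?_, by omega⟩
    have hnew : ∀ j, col (τ.fact.args j) = k := hk
    rw [h₃] at hnew
    rw [← color_newFact hS h₁ hJ i ⟨0, hS.arity_pos _⟩]
    exact hnew _

/-- While there are no violations of level less than `v`, the number of those of level `v` does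
not increase. -/
theorem Next.ncard_violations_le (hS : S.Tame) (h : Next S I θ J) (hfin : I.facts.Finite)
    (hI : Monochromatic I.facts col) (hJ : Monochromatic J.facts col) {v : ℕ}
    (hv : ∀ τ ∈ violations S I col k v, I.level τ.fact = v) :
    (violations S J col k v).ncard ≤ (violations S I col k v).ncard ∧
      (θ = _root_.id → violations S J col k v ⊆ violations S I col k v) := by
  have key : ∀ τ ∈ violations S J col k v, ∃ τ' ∈ violations S I col k v,
      τ'.dep = τ.dep ∧ τ'.fact.map θ = τ.fact := by
    rintro τ ⟨hτ, hk, hl⟩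
    rcases h.violation_origin hτ with ⟨τ', h₁, h₂, h₃, h₄⟩ | ⟨τ', h₁, rfl, h₃, h₄⟩
    · exact ⟨τ', ⟨h₁, color_tup_of_map_eq (h.color_subst hI) h₂ h₃ hk, h₄.le.trans hl⟩, h₂, h₃⟩
    -- A new fact of level at most `v` would come from a violation of level below `v`, which `hv`
    -- excludes.
    · have hk' : ∀ j, col (τ.fact.args j) = k := hk
      rw [h₃] at hk'
      have := hv τ' ⟨h₁, fun i => by
        rw [← color_newFact hS h₁ hJ i ⟨0, hS.arity_pos _⟩]
        exact hk' _, by omega⟩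
      omega
  constructor
  · choose! F hF using key
    refine Set.ncard_le_ncard_of_injOn F (fun τ hτ => (hF τ hτ).1) ?_
      (finite_violations hS hfin v)
    intro τ hτ τ' hτ' he
    refine IDTrigger.eq_of_dep_of_fact ?_ ?_
    · rw [← (hF τ hτ).2.1, ← (hF τ' hτ').2.1, he]
    · rw [← (hF τ hτ).2.2, ← (hF τ' hτ').2.2, he]
  · rintro rfl τ hτ
    obtain ⟨τ', hτ', h₁, h₂⟩ := key τ hτ
    rwa [← IDTrigger.eq_of_dep_of_fact h₁ h₂]

end Chase

namespace Chase

variable {R : RelSchema} {Dom κ : Type*} {S : Deps R} {D : Finset (Atom R Dom)}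
variable {I J : ChaseState R Dom} {θ : Const Dom → Const Dom} {col : Const Dom → κ} {k : κ}

/-! ### The effect of a step on the facts of one color -/

theorem consts_mono {α : Type*} {B B' : Set (Atom R α)} (h : B ⊆ B') : consts B ⊆ consts B' :=
  fun _ ⟨f, hf, i, hi⟩ => ⟨f, h hf, i, hi⟩

theorem consts_image {α β : Type*} (f : α → β) (B : Set (Atom R α)) :
    consts (Atom.map f '' B) = f '' consts B := by
  ext y
  constructor
  · rintro ⟨_, ⟨A, hA, rfl⟩, i, rfl⟩
    exact ⟨_, ⟨A, hA, i, rfl⟩, rfl⟩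
  · rintro ⟨_, ⟨A, hA, i, rfl⟩, rfl⟩
    exact ⟨_, ⟨A, hA, rfl⟩, i, rfl⟩

/-- The facts of color `k` after a step are the images of those before the step, and possibly
the new fact. -/
theorem Next.part_origin (hS : S.Tame) (h : Next S I θ J) (hI : Monochromatic I.facts col)
    (hJ : Monochromatic J.facts col) {g : DBFact R Dom} (hg : g ∈ part J col k) :
    (∃ f ∈ part I col k, f.map θ = g ∧ I.level f = J.level g) ∨
      ∃ τ : IDTrigger R Dom, τ.Applicable S I ∧ θ = _root_.id ∧ J = τ.apply I ∧
        g = τ.newFact I ∧ τ.fact ∈ part I col k ∧ J.level g = I.level τ.fact + 1 := by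
  rcases h.origin hg.1 with ⟨f, hf, rfl, hl⟩ | ⟨τ, happ, hθ, rfl, rfl, hl⟩
  · exact .inl ⟨f, ⟨hf, fun i => (h.color_subst hI _).symm.trans (hg.2 i)⟩, rfl, hl⟩
  · refine .inr ⟨τ, happ, hθ, rfl, rfl, ⟨happ.2.1, fun i => ?_⟩, hl⟩
    exact (color_newFact hS happ hJ i ⟨0, hS.arity_pos _⟩).symm.trans (hg.2 _)

theorem Next.level_part_le (hS : S.Tame) (h : Next S I θ J) (hI : Monochromatic I.facts col)
    (hJ : Monochromatic J.facts col) {M : ℕ} (hM : ∀ f ∈ part I col k, I.level f ≤ M) :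
    ∀ g ∈ part J col k, J.level g ≤ M + 1 := by
  intro g hg
  rcases h.part_origin hS hI hJ hg with ⟨f, hf, -, hl⟩ | ⟨τ, -, -, -, -, hτ, hl⟩
  · exact hl ▸ (hM f hf).trans (Nat.le_succ _)
  · exact hl ▸ Nat.succ_le_succ (hM _ hτ)

theorem consts_part_apply_subset (hS : S.Tame) {τ : IDTrigger R Dom} (happ : τ.Applicable S I)
    (hJ : Monochromatic (τ.apply I).facts col) :
    consts (part (τ.apply I) col k) ⊆ consts (part I col k) ∪
      (fun j : Fin (R.arity τ.dep.tgt) => Const.fresh (I.next + j)) ''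
        {j | ¬ ∃ i, τ.dep.Y i = j} := by
  rintro _ ⟨f, ⟨rfl | hf, hk⟩, i, rfl⟩
  · by_cases hi : ∃ l, τ.dep.Y l = i
    · obtain ⟨l, rfl⟩ := hi
      left
      rw [τ.newFact_args_Y]
      refine ⟨τ.fact, ⟨happ.2.1, fun i => ?_⟩, _, rfl⟩
      exact (color_newFact hS happ hJ i ⟨0, hS.arity_pos _⟩).symm.trans (hk _)
    · right
      exact ⟨i, hi, (τ.newFact_args_of_notMem I hi).symm⟩
  · exact .inl ⟨f, ⟨hf, hk⟩, i, rfl⟩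

theorem Next.ncard_consts_le (hS : S.Tame) {W : ℕ} (hW : ∀ p, R.arity p ≤ W)
    (h : Next S I θ J) (hfin : I.facts.Finite) (hI : Monochromatic I.facts col)
    (hJ : Monochromatic J.facts col) :
    (consts (part J col k)).ncard ≤ (consts (part I col k)).ncard + W := by
  have hc : (consts (part I col k)).Finite := finite_consts (finite_part hfin)
  by_cases hnew : ∃ τ : IDTrigger R Dom, τ.Applicable S I ∧ J = τ.apply I
  · obtain ⟨τ, happ, rfl⟩ := hnew
    refine (Set.ncard_le_ncard (consts_part_apply_subset hS happ hJ)
      (hc.union (Set.toFinite _))).trans ((Set.ncard_union_le _ _).trans ?_)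
    refine Nat.add_le_add_left ?_ _
    refine (Set.ncard_image_le (Set.toFinite _)).trans ?_
    refine (Set.ncard_le_card _).trans ?_
    simpa using hW _
  · have : consts (part J col k) ⊆ θ '' consts (part I col k) := by
      rw [← consts_image]
      refine consts_mono fun g hg => ?_
      rcases h.part_origin hS hI hJ hg with ⟨f, hf, hg, -⟩ | ⟨τ, happ, -, hJ, -⟩
      · exact ⟨f, hf, hg⟩
      · exact (hnew ⟨τ, happ, hJ⟩).elim
    exact ((Set.ncard_le_ncard this (hc.image _)).trans (Set.ncard_image_le hc)).trans
      (Nat.le_add_right _ _)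

/-- A bound on the number of steps that concern the facts of color `k` before all violations of
level `v` are repaired. -/
noncomputable def potential (S : Deps R) (W : ℕ) (I : ChaseState R Dom) (col : Const Dom → κ)
    (k : κ) (v : ℕ) : ℕ :=
  stepBound (atomCount R) W (violations S I col k v).ncard (consts (part I col k)).ncard
    (absent (part I col k)).ncard

theorem Next.part_eq_of_color_ne (h : Next S I θ J) (hI : Monochromatic I.facts col)
    (hθ : ∀ x, col x = k → θ x = x)
    (hpre : ∀ g ∈ part J col k, ∃ f ∈ I.facts, f.map θ = g ∧ I.level f = J.level g) :
    part J col k = part I col k ∧ ∀ f ∈ part I col k, J.level f = I.level f := by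
  have hfix : ∀ f ∈ part I col k, f.map θ = f := fun f hf =>
    Atom.map_eq_self fun i => hθ _ (hf.2 i)
  have hback : ∀ g ∈ part J col k, g ∈ part I col k ∧ I.level g = J.level g := by
    intro g hg
    obtain ⟨f, hf, he, hl⟩ := hpre g hg
    have hfk : f ∈ part I col k :=
      ⟨hf, fun i => by subst he; exact (h.color_subst hI _).symm.trans (hg.2 i)⟩
    rw [hfix f hfk] at he
    exact he ▸ ⟨hfk, he ▸ hl⟩
  have hforth : ∀ f ∈ part I col k, f ∈ part J col k := fun f hf =>
    ⟨hfix f hf ▸ h.map_mem hf.1, hf.2⟩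
  exact ⟨Set.ext fun f => ⟨fun hf => (hback f hf).1, hforth f⟩,
    fun f hf => (hback f (hforth f hf)).2.symm⟩

theorem potential_le_of_part_eq (hS : S.Tame) (W : ℕ) (hfin : I.facts.Finite) {v : ℕ}
    (hp : part J col k = part I col k)
    (hu : (violations S J col k v).ncard ≤ (violations S I col k v).ncard) :
    potential S W J col k v ≤ potential S W I col k v := by
  have := hS.finite_pred
  unfold potential
  rw [hp]
  exact stepBound_mono_left atomCount_mono W hu (ncard_absent_le (finite_part hfin))

/-- `θ` is not injective on the constants of color `k`, since it identifies two distinct tuples over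
them. -/
theorem ncard_consts_lt_of_kd (h : Next S I θ J) {τ : KDTrigger R Dom}
    (happ : τ.Applicable S I) (hθ : IsUnifier τ.pairs θ)
    (hfacts : J.facts = Atom.map θ '' I.facts)
    (hfin : I.facts.Finite) (hI : Monochromatic I.facts col) (hk : ∀ i, col (τ.fst i) = k) :
    (consts (part J col k)).ncard < (consts (part I col k)).ncard := by
  have hc : (consts (part I col k)).Finite := finite_consts (finite_part hfin)
  have hsub : consts (part J col k) ⊆ θ '' consts (part I col k) := by
    rw [← consts_image]
    refine consts_mono fun g hg => ?_
    obtain ⟨hg, hgk⟩ := hg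
    rw [hfacts] at hg
    obtain ⟨f, hf, rfl⟩ := hg
    exact ⟨f, ⟨hf, fun i => (h.color_subst hI _).symm.trans (hgk i)⟩, rfl⟩
  refine (Set.ncard_le_ncard hsub (hc.image _)).trans_lt ?_
  refine (Set.ncard_image_le hc).lt_of_ne fun he => ?_
  have hinj := (Set.ncard_image_iff hc).1 he
  refine happ.2.2.2.1 (funext fun i => hinj ?_ ?_ (hθ.unifies _ ⟨i, rfl⟩))
  · exact ⟨τ.fstFact, ⟨happ.2.1, hk⟩, i, rfl⟩
  · refine ⟨τ.sndFact, ⟨happ.2.2.1, fun j => ?_⟩, i, rfl⟩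
    exact (happ.color_eq hI i j).symm.trans (hk i)

/-- A full-width step keeps the constants and uses up an absent fact, whatever its level. Any other
step repairs one of the counted violations. -/
theorem potential_lt_of_id (hS : S.Tame) {W : ℕ} (hW : ∀ p, R.arity p ≤ W)
    {τ : IDTrigger R Dom} (h : Next S I id (τ.apply I))
    (happ : τ.Applicable S I) (hmin : ¬ τ.dep.FullWidth → ∀ τ' : IDTrigger R Dom,
      τ'.Applicable S I → I.level τ.fact ≤ I.level τ'.fact) (hfin : I.facts.Finite)
    (hI : Monochromatic I.facts col) (hJ : Monochromatic (τ.apply I).facts col) {v : ℕ}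
    (hv : ∀ τ ∈ violations S I col k v, I.level τ.fact = v)
    (hne : (violations S I col k v).Nonempty) (hk : ∀ i, col (τ.tup i) = k) :
    potential S W (τ.apply I) col k v < potential S W I col k v := by
  have := hS.finite_pred
  have hJfin := h.finite_facts hfin
  obtain ⟨hu, hsub⟩ := h.ncard_violations_le hS hfin hI hJ hv
  have hsub := hsub rfl
  have hc : (consts (part I col k)).Finite := finite_consts (finite_part hfin)
  have hpart : part I col k ⊆ part (τ.apply I) col k := fun f hf =>
    ⟨Set.mem_insert_of_mem _ hf.1, hf.2⟩
  by_cases hfull : τ.dep.FullWidth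
  · have hcs : consts (part (τ.apply I) col k) = consts (part I col k) := by
      refine subset_antisymm ?_ (consts_mono hpart)
      refine (consts_part_apply_subset hS happ hJ).trans (Set.union_subset le_rfl ?_)
      rintro _ ⟨j, hj, rfl⟩
      exact (hj (hfull.2 j)).elim
    have hnew : τ.newFact I ∈ part (τ.apply I) col k :=
      ⟨Set.mem_insert _ _, fun j =>
        (color_newFact hS happ hJ ⟨0, hS.arity_pos _⟩ j).trans (hk _)⟩
    unfold potential
    rw [hcs]
    refine stepBound_lt_of_absent_lt atomCount_mono W hu ?_
      (ncard_absent_le (finite_part hfin))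
    refine Set.ncard_lt_ncard ⟨?_, ?_⟩ ((finite_atomsOver hc).subset Set.sdiff_subset)
    · unfold absent
      rw [hcs]
      exact Set.sdiff_subset_sdiff_right hpart
    · intro hle
      have hmem : τ.newFact I ∈ absent (part I col k) :=
        ⟨hcs ▸ subset_atomsOver_consts _ hnew,
          fun hm => IDTrigger.newFact_notMem happ hm.1⟩
      exact (hle hmem).2 hnew
  · obtain ⟨τ', hτ'⟩ := hne
    -- Since the trigger has the least level among all violations, its level is at most `v`.
    have hmem : τ ∈ violations S I col k v :=
      ⟨happ, hk, (hmin hfull τ' hτ'.1).trans hτ'.2.2⟩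
    refine stepBound_lt_of_violations_lt atomCount_mono W ?_
      (h.ncard_consts_le hS hW hfin hI hJ) (ncard_absent_le (finite_part hJfin))
    refine Set.ncard_lt_ncard ⟨hsub, fun hle => ?_⟩ (finite_violations hS hfin v)
    exact (hle hmem).1.2.2 ⟨(τ.newFact I).args, Set.mem_insert _ _, τ.newFact_args_Y I⟩

/-- While there are no violations of level less than `v`, a step decreases the potential unless it
does not concern the color `k`. -/
theorem Next.potential_lt_or (hS : S.Tame) {W : ℕ} (hW : ∀ p, R.arity p ≤ W)
    (h : Next S I θ J) (hfin : I.facts.Finite)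
    (hI : Monochromatic I.facts col) (hJ : Monochromatic J.facts col) {v : ℕ}
    (hv : ∀ τ ∈ violations S I col k v, I.level τ.fact = v)
    (hne : (violations S I col k v).Nonempty) :
    potential S W J col k v < potential S W I col k v ∨
      ((∃ x, col x ≠ k) ∧ potential S W J col k v ≤ potential S W I col k v ∧
        part J col k = part I col k ∧ ∀ f ∈ part I col k, J.level f = I.level f) := by
  have := hS.finite_pred
  have hu := (h.ncard_violations_le hS hfin hI hJ hv).1
  -- The clause `∃ x, col x ≠ k` later excludes this alternative for the one-color coloring.
  have hother : (∃ x, col x ≠ k) → (part J col k = part I col k ∧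
      ∀ f ∈ part I col k, J.level f = I.level f) →
      ((∃ x, col x ≠ k) ∧ potential S W J col k v ≤ potential S W I col k v ∧
        part J col k = part I col k ∧ ∀ f ∈ part I col k, J.level f = I.level f) :=
    fun hx hp => ⟨hx, potential_le_of_part_eq hS W hfin hp.1 hu, hp⟩
  have hcopy := h
  cases h with
  | kd τ _ _ happ hθ hfacts hlevel =>
    by_cases hk : ∀ i, col (τ.fst i) = k
    · left
      exact stepBound_lt_of_consts_lt atomCount_mono W hu
        (ncard_consts_lt_of_kd hcopy happ hθ hfacts hfin hI hk)
        (ncard_absent_le (finite_part (hcopy.finite_facts hfin)))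
    · right
      push Not at hk
      obtain ⟨i, hi⟩ := hk
      refine hother ⟨_, hi⟩ (hcopy.part_eq_of_color_ne hI ?_ ?_)
      · intro x hx
        refine hθ.eq_self ?_
        rintro _ ⟨j, rfl⟩
        have h₁ : col (τ.fst j) = col (τ.fst i) := hI _ happ.2.1 j i
        have h₂ := happ.color_eq hI i j
        constructor
        · rintro rfl
          exact hi (h₁.symm.trans hx)
        · rintro rfl
          exact hi (h₂.trans hx)
      · exact fun g hg => exists_preimage_of_kd hfacts hlevel hg.1
  | id τ hkd happ hmin =>
    by_cases hk : ∀ i, col (τ.tup i) = k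
    · exact .inl (potential_lt_of_id hS hW hcopy happ hmin hfin hI hJ hv hne hk)
    · right
      push Not at hk
      obtain ⟨i, hi⟩ := hk
      refine hother ⟨_, hi⟩ (hcopy.part_eq_of_color_ne hI (fun _ _ => rfl) ?_)
      rintro g ⟨rfl | hg, hgk⟩
      · exact (hi ((color_newFact hS happ hJ i ⟨0, hS.arity_pos _⟩).symm.trans (hgk _))).elim
      · exact ⟨g, hg, rfl, (level_apply_of_mem happ hg).symm⟩
  | idle _ hid =>
    obtain ⟨τ, hτ⟩ := hne
    exact (hid τ hτ.1).elim

end Chase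

namespace Chase

variable {R : RelSchema} {Dom κ : Type*} {S : Deps R} {D : Finset (Atom R Dom)}

/-! ### Levels of the facts that satisfy inclusion dependencies -/

theorem ncard_consts_le_mul {W : ℕ} (hW : ∀ p, R.arity p ≤ W) {α : Type*} {B : Set (Atom R α)}
    (hB : B.Finite) : (consts B).ncard ≤ B.ncard * W := by
  classical
  have : consts B = ↑(hB.toFinset.biUnion fun f => Finset.univ.image f.args) := by
    ext x
    simp [consts]
  rw [this, Set.ncard_coe_finset, Set.ncard_eq_toFinset_card B hB]
  refine Finset.card_biUnion_le_card_mul _ _ _ fun f _ => Finset.card_image_le.trans ?_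
  simpa using hW _

/-- A bound on the potential of a color with at most `c` constants. -/
noncomputable def potentialBound (S : Deps R) (W c : ℕ) : ℕ :=
  stepBound (atomCount R) W (S.ids.ncard * atomCount R c) c (atomCount R c)

theorem potential_le (hS : S.Tame) (W : ℕ) {I : ChaseState R Dom} (hfin : I.facts.Finite)
    {col : Const Dom → κ} {k : κ} {c : ℕ} (hc : (consts (part I col k)).ncard ≤ c) (v : ℕ) :
    potential S W I col k v ≤ potentialBound S W c := by
  have := hS.finite_pred
  have ha := ncard_absent_le (R := R) (finite_part (col := col) (k := k) hfin)
  have hu := (ncard_violations_le (col := col) (k := k) hS hfin v).trans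
    (Nat.mul_le_mul_left S.ids.ncard (atomCount_mono hc))
  exact (stepBound_mono_left atomCount_mono W hu ha).trans
    (stepBound_mono_right atomCount_mono W _ hc (ha.trans (atomCount_mono hc)))

/-- A bound on the levels and the number of constants after a step that starts with bound `y`,
until all violations of the next level are repaired. -/
noncomputable def nextBound (S : Deps R) (W y : ℕ) : ℕ :=
  (y + W + 1) + (W + 1) * potentialBound S W (y + W + 1)

/-- A bound on the levels of the facts of a color that starts with `g` facts and has a violation
of level `v`. -/
noncomputable def levelBound (S : Deps R) (W g : ℕ) : ℕ → ℕ
  | 0 => nextBound S W (g * W)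
  | v + 1 => nextBound S W (levelBound S W g v)

theorem le_nextBound (S : Deps R) (W y : ℕ) : y ≤ nextBound S W y := by
  unfold nextBound
  omega

theorem levelBound_mono (S : Deps R) (W g : ℕ) : Monotone (levelBound S W g) :=
  monotone_nat_of_le_succ fun _ => le_nextBound _ _ _

namespace Run

variable (r : Run S D) {col : Const Dom → κ} {k : κ} {W g : ℕ}

/-- A step in color `k` raises the level bound `M` by at most `1` and the number of constants by at
most `W`, and lowers the potential by at least `1`. With weight `W + 1` on the potential, the sum
cannot grow while violations of level `v` are the lowest. -/
theorem exists_level_bound (hS : S.Tame) (hW : ∀ p, R.arity p ≤ W) (hcol : r.IsColoring col)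
    (hg : (part (init D) col k).ncard ≤ g) (v n : ℕ)
    (hne : (violations S (r.state n) col k v).Nonempty) :
    ∃ M, (∀ f ∈ part (r.state n) col k, (r.state n).level f ≤ M) ∧
      M + (consts (part (r.state n) col k)).ncard + (W + 1) * potential S W (r.state n) col k v ≤
        levelBound S W g v := by
  induction v generalizing n with
  | zero =>
    induction n with
    | zero =>
      refine ⟨0, by simp [r.state_zero, init], ?_⟩
      have hc : (consts (part (r.state 0) col k)).ncard ≤ g * W := by
        refine (ncard_consts_le_mul hW (finite_part (r.finite_facts 0))).trans ?_
        rw [r.state_zero]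
        exact Nat.mul_le_mul_right _ hg
      have hp := potential_le hS W (r.finite_facts 0) (c := g * W + W + 1) (by omega) 0 (col := col)
        (k := k)
      have := Nat.mul_le_mul_left (W + 1) hp
      simp only [levelBound, nextBound]
      omega
    | succ n ih =>
      have hne' := (r.next n).violations_nonempty hS (hcol n) (hcol (n + 1)) hne
      obtain ⟨M, hM, hle⟩ := ih hne'
      exact step_level_bound r hS hW hcol n (fun τ hτ => Nat.le_zero.1 hτ.2.2) hne' hM hle
  | succ v ihv =>
    induction n with
    | zero =>
      obtain ⟨τ, h₁, h₂, -⟩ := hne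
      obtain ⟨M, hM, hle⟩ := ihv 0 ⟨τ, h₁, h₂, by simp [r.state_zero, init]⟩
      refine ⟨M, hM, ?_⟩
      have hp := potential_le hS W (r.finite_facts 0) (c := levelBound S W g v + W + 1) (by omega)
        (v + 1) (col := col) (k := k)
      have := Nat.mul_le_mul_left (W + 1) hp
      simp only [levelBound, nextBound]
      omega
    | succ n ih =>
      have hne' := (r.next n).violations_nonempty hS (hcol n) (hcol (n + 1)) hne
      -- Either violations of level at most `v` remain at stage `n`, and one step beyond the bound
      -- for `v` is allowed for by the term `W + 1` in `nextBound`; or the lowest level is exactly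
      -- `v + 1` and the potential argument applies.
      by_cases hlow : (violations S (r.state n) col k v).Nonempty
      · obtain ⟨M, hM, hle⟩ := ihv n hlow
        refine ⟨M + 1, (r.next n).level_part_le hS (hcol n) (hcol (n + 1)) hM, ?_⟩
        have hc := (r.next n).ncard_consts_le hS hW (r.finite_facts n) (hcol n) (hcol (n + 1))
          (k := k)
        have hp := potential_le hS W (r.finite_facts (n + 1)) (c := levelBound S W g v + W + 1)
          (by omega) (v + 1) (col := col) (k := k)
        have := Nat.mul_le_mul_left (W + 1) hp
        simp only [levelBound, nextBound]
        omega
      · obtain ⟨M, hM, hle⟩ := ih hne'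
        refine step_level_bound r hS hW hcol n (fun τ hτ => ?_) hne' hM hle
        by_contra hlt
        exact hlow ⟨τ, hτ.1, hτ.2.1, by have := hτ.2.2; omega⟩
where
  step_level_bound (r : Run S D) {col : Const Dom → κ} {k : κ} {W v M b : ℕ} (hS : S.Tame)
      (hW : ∀ p, R.arity p ≤ W) (hcol : r.IsColoring col) (n : ℕ)
      (hv : ∀ τ ∈ violations S (r.state n) col k v, (r.state n).level τ.fact = v)
      (hne : (violations S (r.state n) col k v).Nonempty)
      (hM : ∀ f ∈ part (r.state n) col k, (r.state n).level f ≤ M)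
      (hle : M + (consts (part (r.state n) col k)).ncard +
        (W + 1) * potential S W (r.state n) col k v ≤ b) :
      ∃ M, (∀ f ∈ part (r.state (n + 1)) col k, (r.state (n + 1)).level f ≤ M) ∧
        M + (consts (part (r.state (n + 1)) col k)).ncard +
          (W + 1) * potential S W (r.state (n + 1)) col k v ≤ b := by
    rcases (r.next n).potential_lt_or hS hW (r.finite_facts n) (hcol n) (hcol (n + 1)) hv hne with
      hlt | ⟨-, hp, hpart, hlev⟩
    · refine ⟨M + 1, (r.next n).level_part_le hS (hcol n) (hcol (n + 1)) hM, ?_⟩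
      have hc := (r.next n).ncard_consts_le hS hW (r.finite_facts n) (hcol n) (hcol (n + 1))
        (k := k)
      have := Nat.mul_le_mul_left (W + 1) (Nat.succ_le_of_lt hlt)
      rw [Nat.mul_succ] at this
      omega
    · refine ⟨M, ?_, ?_⟩
      · rw [hpart]
        intro f hf
        exact hlev f hf ▸ hM f hf
      · rw [hpart]
        have := Nat.mul_le_mul_left (W + 1) hp
        omega

/-- Used contrapositively in spirit: no fact of a color can run far ahead of a violation in that
color. -/
theorem level_le_of_violation (hS : S.Tame) (hW : ∀ p, R.arity p ≤ W) (hcol : r.IsColoring col)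
    (hg : ∀ k, (part (init D) col k).ncard ≤ g) {n : ℕ} {τ : IDTrigger R Dom}
    (hτ : τ.Applicable S (r.state n)) {f : DBFact R Dom} (hf : f ∈ (r.state n).facts)
    {i : Fin (R.arity τ.dep.src)} {j : Fin (R.arity f.pred)}
    (hij : col (f.args j) = col (τ.tup i)) :
    (r.state n).level f ≤ levelBound S W g ((r.state n).level τ.fact) := by
  obtain ⟨M, hM, hle⟩ := r.exists_level_bound hS hW hcol (hg (col (τ.tup i))) _ n
    ⟨τ, hτ, fun l => hcol n _ hτ.2.1 l i, le_rfl⟩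
  have := hM f ⟨hf, fun l => (hcol n f hf l j).trans hij⟩
  omega

/-- Every inclusion dependency is violated by a fact, or satisfied by means of a fact whose level
is bounded in terms of that of the first fact. -/
theorem exists_witness_level_le (hS : S.Tame) (hW : ∀ p, R.arity p ≤ W)
    (hcol : r.IsColoring col) (hg : ∀ k, (part (init D) col k).ncard ≤ g) (n : ℕ)
    (τ : IDTrigger R Dom) (hdep : τ.dep ∈ S.ids) (hfact : τ.fact ∈ (r.state n).facts) :
    τ.Applicable S (r.state n) ∨ ∃ t : Fin (R.arity τ.dep.tgt) → Const Dom,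
      (⟨τ.dep.tgt, t⟩ : DBFact R Dom) ∈ (r.state n).facts ∧
      (∀ i, t (τ.dep.Y i) = τ.tup (τ.dep.X i)) ∧
      (r.state n).level ⟨τ.dep.tgt, t⟩ ≤ levelBound S W g ((r.state n).level τ.fact) + 1 := by
  induction n generalizing τ with
  | zero =>
    by_cases happ : τ.Applicable S (r.state 0)
    · exact .inl happ
    · right
      simp only [IDTrigger.Applicable, hdep, hfact, true_and, not_not] at happ
      obtain ⟨t, ht, hm⟩ := happ
      exact ⟨t, ht, hm, by simp [r.state_zero, init]⟩
  | succ n ih =>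
    by_cases happ : τ.Applicable S (r.state (n + 1))
    · exact .inl happ
    right
    simp only [IDTrigger.Applicable, hdep, hfact, true_and, not_not] at happ
    obtain ⟨t, ht, hm⟩ := happ
    have hw := hS.width_pos _ hdep
    have htcol : ∀ j i, col (t j) = col (τ.tup i) := by
      intro j i
      have h₁ : col (t j) = col (t (τ.dep.Y ⟨0, hw⟩)) := hcol _ _ ht j _
      rw [h₁, hm]
      exact hcol _ _ hfact _ i
    -- If a violation in this color was still present at stage `n`, all facts of the color, the
    -- witness `t` included, have bounded level at stage `n + 1`.
    have hany : ∀ τ' : IDTrigger R Dom, τ'.Applicable S (r.state n) →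
        (r.state n).level τ'.fact ≤ (r.state (n + 1)).level τ.fact →
        (∀ i j, col (τ'.tup i) = col (τ.tup j)) →
        (r.state (n + 1)).level ⟨τ.dep.tgt, t⟩ ≤
          levelBound S W g ((r.state (n + 1)).level τ.fact) + 1 := by
      intro τ' hτ' hl hc
      have hb := levelBound_mono S W g hl
      have i₀ : Fin (R.arity τ'.dep.src) := ⟨0, hS.arity_pos _⟩
      have j₀ : Fin (R.arity τ.dep.src) := ⟨0, hS.arity_pos _⟩
      have := (r.next n).level_part_le hS (hcol n) (hcol (n + 1))
        (k := col (τ.tup j₀)) (M := levelBound S W g ((r.state n).level τ'.fact))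
        (fun f hf => r.level_le_of_violation hS hW hcol hg hτ' hf.1 (i := i₀)
          (j := ⟨0, hS.arity_pos _⟩) ((hf.2 _).trans (hc _ _).symm))
        ⟨τ.dep.tgt, t⟩ ⟨ht, fun j => htcol j j₀⟩
      omega
    -- An old fact either violated the dependency at stage `n` or had a witness whose image serves;
    -- a new fact has a violating parent of smaller level.
    rcases (r.next n).origin hfact with ⟨⟨p, s⟩, hf, he, hl⟩ | ⟨τ', hτ', -, hstate, he, hl⟩
    · obtain ⟨d, u⟩ := τ
      have he' := he
      simp only [Atom.map, IDTrigger.fact, Atom.mk.injEq] at he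
      obtain ⟨rfl, he⟩ := he
      simp only [heq_eq_eq] at he
      subst he
      rcases ih ⟨d, s⟩ hdep hf with hviol | ⟨t', ht', hm', hl'⟩
      · refine ⟨t, ht, hm, hany _ hviol hl.le fun i j => ?_⟩
        exact (hcol n _ hf i j).trans (hcol.color_subst n _).symm
      · refine ⟨fun j => r.subst n (t' j), (r.next n).map_mem ht',
          fun i => congrArg (r.subst n) (hm' i), ?_⟩
        refine ((r.next n).level_map_le ht').trans ?_
        rw [← hl]
        exact hl'
    · refine ⟨t, ht, hm, hany τ' hτ' (by omega) fun i j => ?_⟩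
      have hk : ∀ j, col (τ.fact.args j) = col (τ.tup ⟨0, hS.arity_pos _⟩) :=
        fun j => hcol _ _ hfact _ _
      rw [he] at hk
      have hmono := hcol (n + 1)
      rw [hstate] at hmono
      exact (color_newFact hS hτ' hmono i ⟨0, hS.arity_pos _⟩).symm.trans
        ((hk _).trans (hcol _ _ hfact _ j))

/-! ### Fairness -/

/-- With a single color, the estimates for one color concern the whole stage and yield fairness. -/
theorem isColoring_unit : r.IsColoring fun _ => () := fun _ _ _ _ _ => rfl

theorem violations_unit_nonempty_of_le (hS : S.Tame) {v m n : ℕ} (hmn : m ≤ n)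
    (hne : (violations S (r.state n) (fun _ => ()) () v).Nonempty) :
    (violations S (r.state m) (fun _ => ()) () v).Nonempty := by
  induction n, hmn using Nat.le_induction with
  | base => exact hne
  | succ n _ ih =>
    exact ih ((r.next n).violations_nonempty hS (r.isColoring_unit n)
      (r.isColoring_unit (n + 1)) hne)

/-- Inclusion dependencies are eventually satisfied by all facts of low level. -/
theorem eventually_no_violation (hS : S.Tame) (v : ℕ) :
    ∃ N, ∀ n, N ≤ n → ∀ τ : IDTrigger R Dom, τ.Applicable S (r.state n) →
      v < (r.state n).level τ.fact := by
  have := hS.finite_pred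
  obtain ⟨W, hW⟩ : ∃ W, ∀ p, R.arity p ≤ W := by
    obtain ⟨W, hW⟩ := (Set.finite_range R.arity).bddAbove
    exact ⟨W, fun p => hW ⟨p, rfl⟩⟩
  suffices h : ∃ N, ¬ (violations S (r.state N) (fun _ => ()) () v).Nonempty by
    obtain ⟨N, hN⟩ := h
    refine ⟨N, fun n hn τ hτ => ?_⟩
    by_contra hlt
    exact hN (r.violations_unit_nonempty_of_le hS hn ⟨τ, hτ, fun _ => rfl, not_lt.1 hlt⟩)
  induction v with
  | zero =>
    by_contra hall
    push Not at hall
    exact descent r hS hW 0 0 (fun _ _ τ hτ => Nat.le_zero.1 hτ.2.2) hall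
  | succ v ih =>
    obtain ⟨N, hN⟩ := ih
    by_contra hall
    push Not at hall
    refine descent r hS hW (v + 1) N (fun n hn τ hτ => ?_) hall
    by_contra hlt
    exact hN (r.violations_unit_nonempty_of_le hS hn
      ⟨τ, hτ.1, hτ.2.1, by have := hτ.2.2; omega⟩)
where
  descent (r : Run S D) (hS : S.Tame) {W : ℕ} (hW : ∀ p, R.arity p ≤ W) (v N : ℕ)
      (hv : ∀ n, N ≤ n → ∀ τ ∈ violations S (r.state n) (fun _ => ()) () v,
        (r.state n).level τ.fact = v)
      (hall : ∀ n, (violations S (r.state n) (fun _ => ()) () v).Nonempty) : False := by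
    -- With one color every step concerns it, so the potential would decrease forever.
    have hdec : ∀ m, potential S W (r.state (N + m)) (fun _ => ()) () v + m ≤
        potential S W (r.state N) (fun _ => ()) () v := by
      intro m
      induction m with
      | zero => exact le_rfl
      | succ m ih =>
        rcases (r.next (N + m)).potential_lt_or hS hW (r.finite_facts _)
          (r.isColoring_unit _) (r.isColoring_unit _) (hv _ (Nat.le_add_right _ _))
          (hall _) with hlt | ⟨⟨x, hx⟩, -⟩
        · rw [← Nat.add_assoc N m 1]
          omega
        · exact (hx rfl).elim
    have := hdec (potential S W (r.state N) (fun _ => ()) () v + 1)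
    omega

/-- Key dependencies are satisfied infinitely often. -/
theorem exists_no_kd_violation (N : ℕ) :
    ∃ n, N ≤ n ∧ ∀ τ : KDTrigger R Dom, ¬ τ.Applicable S (r.state n) := by
  by_contra hall
  push Not at hall
  -- If a key violation is always present, every step merges constants and their number decreases
  -- forever.
  have hlt : ∀ n, N ≤ n → (consts (part (r.state (n + 1)) (fun _ => ()) ())).ncard <
      (consts (part (r.state n) (fun _ => ()) ())).ncard := by
    intro n hn
    obtain ⟨τ, hτ⟩ := hall n hn
    have hnext := r.next n
    generalize r.state (n + 1) = J at hnext ⊢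
    generalize r.subst n = θ at hnext
    have hcopy := hnext
    cases hnext with
    | kd τ' _ _ happ hθ hfacts =>
      exact ncard_consts_lt_of_kd hcopy happ hθ hfacts (r.finite_facts n)
        (r.isColoring_unit n) fun _ => rfl
    | id _ hkd => exact (hkd τ hτ).elim
    | idle hkd => exact (hkd τ hτ).elim
  have hdec : ∀ m, (consts (part (r.state (N + m)) (fun _ => ()) ())).ncard + m ≤
      (consts (part (r.state N) (fun _ => ()) ())).ncard := by
    intro m
    induction m with
    | zero => exact le_rfl
    | succ m ih =>
      have := hlt (N + m) (Nat.le_add_right _ _)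
      rw [← Nat.add_assoc N m 1]
      omega
  have := hdec ((consts (part (r.state N) (fun _ => ()) ())).ncard + 1)
  omega

end Run

end Chase

namespace Chase

variable {R : RelSchema} {Dom κ : Type*} {S : Deps R} {D : Finset (Atom R Dom)}

namespace Run

variable (r : Run S D)

/-! ### The limit of a run -/

/-- The facts that are present with level at most `m` from some stage on. -/
def low (m : ℕ) : Set (DBFact R Dom) :=
  {f | ∃ N, ∀ n, N ≤ n → f ∈ (r.state n).facts ∧ (r.state n).level f ≤ m}

theorem low_mono {m m' : ℕ} (h : m ≤ m') : r.low m ⊆ r.low m' :=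
  fun _ ⟨N, hN⟩ => ⟨N, fun n hn => ⟨(hN n hn).1, (hN n hn).2.trans h⟩⟩

/-- The replacement of constants in the `k` steps after stage `n`. -/
def iter (n : ℕ) : ℕ → Const Dom → Const Dom
  | 0, x => x
  | k + 1, x => r.subst (n + k) (iter n k x)

theorem map_iter_mem (n k : ℕ) {f : DBFact R Dom} (hf : f ∈ (r.state n).facts) :
    f.map (r.iter n k) ∈ (r.state (n + k)).facts ∧
      (r.state (n + k)).level (f.map (r.iter n k)) ≤ (r.state n).level f := by
  induction k with
  | zero => exact ⟨hf, le_rfl⟩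
  | succ k ih =>
    exact ⟨(r.next (n + k)).map_mem ih.1, ((r.next (n + k)).level_map_le ih.1).trans ih.2⟩

theorem exists_iter_eq (n : ℕ) (x : Const Dom) : ∃ y K, ∀ k, K ≤ k → r.iter n k x = y := by
  obtain ⟨K, hK⟩ : ∃ K, ∀ k, weight (r.iter n K x) ≤ weight (r.iter n k x) :=
    ⟨_, fun k => Function.argmin_le (fun k => weight (r.iter n k x)) k⟩
  refine ⟨r.iter n K x, K, fun k hk => ?_⟩
  induction k, hk using Nat.le_induction with
  | base => rfl
  | succ k _ ih =>
    rcases (r.next (n + k)).eq_or_weight_lt (r.iter n k x) with h | h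
    · exact h.trans ih
    · have := hK (k + 1)
      rw [ih] at h
      simp only [iter, ih] at this
      omega

theorem iter_eq_self {n : ℕ} {x : Const Dom} (hx : ∀ m, n ≤ m → r.subst m x = x) (k : ℕ) :
    r.iter n k x = x := by
  induction k with
  | zero => rfl
  | succ k ih => rw [iter, ih, hx _ (Nat.le_add_right _ _)]

/-- `L` sends each constant to the final value of its replacements after stage `n`; the finitely
many arguments of a fact stabilize together. -/
theorem exists_limit (n : ℕ) : ∃ L : Const Dom → Const Dom,
    (∀ f ∈ (r.state n).facts, f.map L ∈ r.low ((r.state n).level f)) ∧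
      ∀ x, (∀ m, n ≤ m → r.subst m x = x) → L x = x := by
  choose L K hL using r.exists_iter_eq n
  refine ⟨L, fun f hf => ?_, fun x hx => ?_⟩
  · refine ⟨n + Finset.univ.sup fun i => K (f.args i), fun m hm => ?_⟩
    obtain ⟨k, rfl⟩ := Nat.exists_eq_add_of_le ((Nat.le_add_right _ _).trans hm)
    have : f.map L = f.map (r.iter n k) := Atom.map_congr fun i => by
      refine (hL _ k (le_trans ?_ (Nat.le_of_add_le_add_left hm))).symm
      exact Finset.le_sup (f := fun i => K (f.args i)) (Finset.mem_univ i)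
    rw [this]
    exact r.map_iter_mem n k hf
  · rw [← hL x _ le_rfl, r.iter_eq_self hx]

theorem subst_args_eq_of_mem {n : ℕ} {f : DBFact R Dom} (hf : f ∈ (r.state (n + 1)).facts)
    (i : Fin (R.arity f.pred)) : r.subst n (f.args i) = f.args i :=
  Atom.args_eq_of_map_eq_self ((r.next n).map_eq_self hf) i

theorem map_dom_mem_low {A : Atom R Dom} (hA : A ∈ D) : A.map Const.dom ∈ r.low 0 := by
  refine ⟨0, fun n _ => ?_⟩
  induction n with
  | zero =>
    rw [r.state_zero]
    exact ⟨⟨A, hA, rfl⟩, le_rfl⟩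
  | succ n ih =>
    obtain ⟨h₁, h₂⟩ := ih (Nat.zero_le _)
    have he : (A.map Const.dom).map (r.subst n) = A.map Const.dom :=
      Atom.map_eq_self fun i => (r.next n).dom _
    have h₃ := (r.next n).map_mem h₁
    have h₄ := (r.next n).level_map_le h₁
    rw [he] at h₃ h₄
    exact ⟨h₃, h₄.trans h₂⟩

/-- The limit satisfies the key dependencies. -/
theorem low_kd {κ : KeyDep R} (hκ : κ ∈ S.kds) {m m' : ℕ}
    {s t : Fin (R.arity κ.pred) → Const Dom} (hs : (⟨κ.pred, s⟩ : DBFact R Dom) ∈ r.low m)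
    (ht : (⟨κ.pred, t⟩ : DBFact R Dom) ∈ r.low m') (hkey : ∀ i ∈ κ.key, s i = t i) : s = t := by
  obtain ⟨N, hN⟩ := hs
  obtain ⟨N', hN'⟩ := ht
  obtain ⟨n, hn, hno⟩ := r.exists_no_kd_violation (max N N')
  by_contra hne
  exact hno ⟨κ, s, t⟩ ⟨hκ, (hN n ((le_max_left _ _).trans hn)).1,
    (hN' n ((le_max_right _ _).trans hn)).1, hne, hkey⟩

/-- The limit satisfies the inclusion dependencies, with control of the levels. -/
theorem low_id (hS : S.Tame) {W g : ℕ} (hW : ∀ p, R.arity p ≤ W) {col : Const Dom → κ}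
    (hcol : r.IsColoring col) (hg : ∀ k, (part (init D) col k).ncard ≤ g) {σ : InclDep R}
    (hσ : σ ∈ S.ids) {m : ℕ} {s : Fin (R.arity σ.src) → Const Dom}
    (hs : (⟨σ.src, s⟩ : DBFact R Dom) ∈ r.low m) :
    ∃ t : Fin (R.arity σ.tgt) → Const Dom,
      (⟨σ.tgt, t⟩ : DBFact R Dom) ∈ r.low (levelBound S W g m + 1) ∧
        ∀ i, t (σ.Y i) = s (σ.X i) := by
  obtain ⟨N, hN⟩ := hs
  obtain ⟨N', hN'⟩ := r.eventually_no_violation hS m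
  obtain ⟨h₁, h₂⟩ := hN (max N N') (le_max_left _ _)
  rcases r.exists_witness_level_le hS hW hcol hg (max N N') ⟨σ, s⟩ hσ h₁ with
    happ | ⟨t, ht, hm, hl⟩
  · exact absurd (hN' _ (le_max_right _ _) _ happ) (not_lt.2 h₂)
  · obtain ⟨L, hL, hfix⟩ := r.exists_limit (max N N')
    refine ⟨fun j => L (t j), r.low_mono (hl.trans ?_) (hL _ ht), fun i => ?_⟩
    · exact Nat.succ_le_succ (levelBound_mono S W g h₂)
    -- The constants of `s` stay fixed because the fact persists at all later stages.
    · refine (congrArg L (hm i)).trans (hfix _ fun n hn => ?_)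
      exact r.subst_args_eq_of_mem (f := ⟨σ.src, s⟩)
        (hN (n + 1) (((le_max_left _ _).trans hn).trans (Nat.le_succ n))).1 (σ.X i)

theorem mem_firstLevels [LinearOrder (DBFact R Dom)] [LinearOrder (InclDep R)]
    [LinearOrder (KeyDep R)] (hr : ∀ n, stage S D n = some (r.state n)) {m : ℕ}
    {f : DBFact R Dom} (hf : f ∈ r.low m) : f ∈ firstLevels S D m := by
  obtain ⟨N, hN⟩ := hf
  obtain ⟨K, hK⟩ : ∃ K, ∀ k, (r.state (N + K)).level f ≤ (r.state (N + k)).level f :=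
    ⟨_, fun k => Function.argmin_le (fun k => (r.state (N + k)).level f) k⟩
  refine ⟨(r.state (N + K)).level f, (hN _ (Nat.le_add_right _ _)).2, ?_⟩
  refine Filter.eventually_atTop.2 ⟨N + K, fun n hn => ⟨_, hr n, (hN n (by omega)).1, ?_⟩⟩
  -- The level of a persistent fact never rises, so it is constant once its minimum is reached.
  induction n, hn using Nat.le_induction with
  | base => rfl
  | succ n hn ih =>
    obtain ⟨k, rfl⟩ := Nat.exists_eq_add_of_le ((Nat.le_add_right _ _).trans hn)
    have h := (r.next (N + k)).level_map_le (hN (N + k) (by omega)).1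
    rw [(r.next (N + k)).map_eq_self (hN (N + k + 1) (by omega)).1] at h
    exact le_antisymm (h.trans ih.le) (hK (k + 1))

end Run

/-! ### Comparison of runs -/

/-- A bound on the levels of the images of the facts of stage `n` of another run. -/
noncomputable def transferBound (S : Deps R) (W g : ℕ) : ℕ → ℕ
  | 0 => 0
  | n + 1 => max (transferBound S W g n) (levelBound S W g (transferBound S W g n) + 1)

/-- The facts of a run with colors in `K` map to facts of bounded level of another run, if the
atoms of the database with colors in `K` do. -/
theorem Run.exists_transfer (hS : S.Tame) {W g : ℕ} (hW : ∀ p, R.arity p ≤ W)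
    {D₁ D₂ : Finset (Atom R Dom)} {κ₁ κ₂ : Type*} (r₁ : Run S D₁) {col₁ : Const Dom → κ₁}
    (hcol₁ : r₁.IsColoring col₁) (K : Set κ₁) (r₂ : Run S D₂) {col₂ : Const Dom → κ₂}
    (hcol₂ : r₂.IsColoring col₂) (hg : ∀ k, (part (init D₂) col₂ k).ncard ≤ g) (π : Dom → Dom)
    (hπ : ∀ A ∈ D₁, (∀ i, col₁ (.dom (A.args i)) ∈ K) → A.map π ∈ D₂) (n : ℕ) :
    ∃ h : Const Dom → Const Dom, (∀ c, h (.dom c) = .dom (π c)) ∧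
      ∀ f ∈ (r₁.state n).facts, (∀ i, col₁ (f.args i) ∈ K) →
        f.map h ∈ r₂.low (transferBound S W g n) := by
  classical
  induction n with
  | zero =>
    refine ⟨fun x => match x with
      | .dom c => .dom (π c)
      | .fresh k => .fresh k, fun _ => rfl, ?_⟩
    rw [r₁.state_zero]
    rintro _ ⟨A, hA, rfl⟩ hK
    exact r₂.map_dom_mem_low (hπ A hA hK)
  | succ n ih =>
    obtain ⟨h, hdom, hh⟩ := ih
    have hle := le_max_left (transferBound S W g n)
      (levelBound S W g (transferBound S W g n) + 1)
    have hnext := r₁.next n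
    have hmono := hcol₁ (n + 1)
    have hsubst := hcol₁.color_subst n
    generalize r₁.state (n + 1) = J at hnext hmono ⊢
    generalize r₁.subst n = θ at hnext hsubst
    cases hnext with
    | kd τ _ _ happ hθ hfacts =>
      refine ⟨h, hdom, ?_⟩
      rw [hfacts]
      rintro _ ⟨f, hf, rfl⟩ hK
      have hfK : ∀ i, col₁ (f.args i) ∈ K := fun i => hsubst (f.args i) ▸ hK i
      suffices he : (f.map θ).map h = f.map h by
        rw [he]
        exact r₂.low_mono hle (hh f hf hfK)
      rw [Atom.map_map]
      refine Atom.map_congr fun i => ?_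
      -- If the merged tuples have colors in `K`, their images agree on the key and so coincide in
      -- the limit of `r₂`; thus `h` factors through `θ`. Otherwise `θ` leaves the constants of `f`
      -- alone.
      by_cases hτ : ∀ j, col₁ (τ.fst j) ∈ K
      · have hτ' : ∀ j, col₁ (τ.snd j) ∈ K := fun j => happ.color_eq (hcol₁ n) j j ▸ hτ j
        have heq := r₂.low_kd happ.1 (hh _ happ.2.1 hτ) (hh _ happ.2.2.1 hτ')
          fun j hj => congrArg h (happ.2.2.2.2 j hj)
        refine hθ.factor h ?_ _
        rintro _ ⟨j, rfl⟩
        exact congrFun heq j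
      · push Not at hτ
        obtain ⟨l, hl⟩ := hτ
        refine congrArg h (hθ.eq_self ?_)
        rintro _ ⟨j, rfl⟩
        have h₁ : col₁ (τ.fst j) = col₁ (τ.fst l) := hcol₁ n _ happ.2.1 j l
        have h₂ : col₁ (τ.fst l) = col₁ (τ.snd j) := happ.color_eq (hcol₁ n) l j
        constructor
        · intro (e : f.args i = τ.fst j)
          exact hl (h₁ ▸ e ▸ hfK i)
        · intro (e : f.args i = τ.snd j)
          exact hl (h₂ ▸ e ▸ hfK i)
    | id τ hkd happ hmin =>
      by_cases hτ : ∀ j, col₁ (τ.tup j) ∈ K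
      · obtain ⟨t, ht, hm⟩ := r₂.low_id hS hW hcol₂ hg happ.1 (hh _ happ.2.1 hτ)
        -- The new fresh constants go to the corresponding entries of a witness in `r₂`; old
        -- constants keep their images.
        let h' : Const Dom → Const Dom := fun x =>
          if hx : ∃ j : Fin (R.arity τ.dep.tgt), x = .fresh ((r₁.state n).next + j)
          then t hx.choose else h x
        have hold : ∀ x, Old (r₁.state n).next x → h' x = h x := by
          intro x hx
          refine dif_neg ?_
          rintro ⟨j, rfl⟩
          simp [Old] at hx
        refine ⟨h', fun c => (hold (.dom c) trivial).trans (hdom c), ?_⟩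
        rintro f (rfl | hf) hK
        · refine r₂.low_mono (le_max_right _ _) ?_
          convert ht using 1
          simp only [Atom.map, IDTrigger.newFact, Atom.mk.injEq, heq_eq_eq, true_and]
          funext j
          by_cases hj : ∃ i, τ.dep.Y i = j
          · obtain ⟨i, rfl⟩ := hj
            have e := τ.newFact_args_Y (r₁.state n) i
            simp only [IDTrigger.newFact] at e
            rw [e]
            exact (hold _ (r₁.old n _ happ.2.1 _)).trans (hm i).symm
          · rw [dif_neg hj]
            have hx : ∃ j' : Fin (R.arity τ.dep.tgt),
                (Const.fresh ((r₁.state n).next + j) : Const Dom) =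
                  .fresh ((r₁.state n).next + j') := ⟨j, rfl⟩
            have hc : hx.choose = j :=
              Fin.ext (Nat.add_left_cancel (Const.fresh.inj hx.choose_spec)).symm
            exact (dif_pos hx).trans (congrArg t hc)
        · refine r₂.low_mono hle ?_
          rw [Atom.map_congr fun i => hold _ (r₁.old n f hf i)]
          exact hh f hf hK
      · refine ⟨h, hdom, ?_⟩
        rintro f (rfl | hf) hK
        -- The new fact has the color of its source, hence its color is not in `K` and nothing is
        -- claimed about it.
        · refine (hτ fun j => ?_).elim
          rw [← color_newFact hS happ hmono j ⟨0, hS.arity_pos _⟩]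
          exact hK _
        · exact r₂.low_mono hle (hh f hf hK)
    | idle => exact ⟨h, hdom, fun f hf hK => r₂.low_mono hle (hh f hf hK)⟩

end Chase

namespace Chase

variable {R : RelSchema} {Dom Var : Type*} {S : Deps R} {D : Finset (Atom R Dom)}

/-! ### The coloring by the components of the join graph -/

open Classical in
/-- The component of the join graph in which a constant occurs. -/
noncomputable def component (D : Finset (Atom R Dom)) :
    Const Dom → Option (joinGraph D).ConnectedComponent
  | .dom c =>
    if h : ∃ A : {A : Atom R Dom // A ∈ D}, ∃ i, A.1.args i = c then
      some ((joinGraph D).connectedComponentMk h.choose)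
    else none
  | .fresh _ => none

/-- The atom chosen for the constant equals `A` or is adjacent to it. -/
theorem component_args {A : Atom R Dom} (hA : A ∈ D) (i : Fin (R.arity A.pred)) :
    component D (.dom (A.args i)) = some ((joinGraph D).connectedComponentMk ⟨A, hA⟩) := by
  have h : ∃ B : {B : Atom R Dom // B ∈ D}, ∃ j, B.1.args j = A.args i := ⟨⟨A, hA⟩, i, rfl⟩
  simp only [component, dif_pos h, Option.some.injEq]
  obtain ⟨j, hj⟩ := h.choose_spec
  rw [SimpleGraph.ConnectedComponent.eq]
  by_cases he : h.choose = ⟨A, hA⟩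
  · rw [he]
  · exact SimpleGraph.Adj.reachable ⟨he, j, i, hj⟩

theorem ncard_supp_le_largestComponent (K : (joinGraph D).ConnectedComponent) :
    K.supp.ncard ≤ largestComponent D := by
  have : Finite (joinGraph D).ConnectedComponent :=
    Finite.of_surjective (joinGraph D).connectedComponentMk Quot.mk_surjective
  exact le_ciSup (f := fun K : (joinGraph D).ConnectedComponent => K.supp.ncard)
    (Set.finite_range _).bddAbove K

theorem ncard_part_init_le (hS : S.Tame) {col : Const Dom → Option (joinGraph D).ConnectedComponent}
    (hcol : ∀ c, col (.dom c) = component D (.dom c))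
    (k : Option (joinGraph D).ConnectedComponent) :
    (part (init D) col k).ncard ≤ largestComponent D := by
  cases k with
  | none =>
    have : part (init D) col none = ∅ := by
      refine Set.eq_empty_of_forall_notMem ?_
      rintro _ ⟨⟨A, hA, rfl⟩, hk⟩
      have h := hk ⟨0, hS.arity_pos _⟩
      have h' := (hcol _).trans (component_args hA ⟨0, hS.arity_pos _⟩)
      exact Option.some_ne_none _ (h'.symm.trans h)
    simp [this]
  | some K =>
    have hsub : part (init D) col (some K) ⊆
        (fun A : {A : Atom R Dom // A ∈ D} => A.1.map Const.dom) '' K.supp := by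
      rintro _ ⟨⟨A, hA, rfl⟩, hk⟩
      have h := hk ⟨0, hS.arity_pos _⟩
      have h' := (hcol _).trans (component_args hA ⟨0, hS.arity_pos _⟩)
      exact ⟨⟨A, hA⟩, Option.some_injective _ (h'.symm.trans h), rfl⟩
    exact ((Set.ncard_le_ncard hsub (Set.toFinite _)).trans
      (Set.ncard_image_le (Set.toFinite _))).trans (ncard_supp_le_largestComponent K)

/-- The atoms of the database whose constants have colors in `K`. -/
def atomsColored {κ : Type*} (D : Finset (Atom R Dom)) (col : Const Dom → κ) (K : Set κ) :
    Set (Atom R Dom) :=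
  {A | A ∈ D ∧ ∀ i, col (.dom (A.args i)) ∈ K}

theorem map_dom_image_atomsColored {κ : Type*} (col : Const Dom → κ) (k : κ) :
    Atom.map Const.dom '' atomsColored D col {k} = part (init D) col k := by
  ext f
  constructor
  · rintro ⟨A, ⟨hA, hk⟩, rfl⟩
    exact ⟨⟨A, hA, rfl⟩, hk⟩
  · rintro ⟨⟨A, hA, rfl⟩, hk⟩
    exact ⟨A, ⟨hA, hk⟩, rfl⟩

theorem finite_atomsColored {κ : Type*} (col : Const Dom → κ) (K : Set κ) :
    (atomsColored D col K).Finite :=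
  D.finite_toSet.subset fun _ h => h.1

/-- Each of the selected colors contributes at most `g` atoms; positive arity ensures that an atom
has a color. -/
theorem ncard_atomsColored_le (hS : S.Tame) {κ ι : Type*} {col : Const Dom → κ} {g : ℕ}
    (hD : ∀ A ∈ D, ∀ i j, col (.dom (A.args i)) = col (.dom (A.args j)))
    (hg : ∀ k, (part (init D) col k).ncard ≤ g) (s : Finset ι) (c : ι → κ) :
    (atomsColored D col (c '' s)).ncard ≤ s.card * g := by
  classical
  have hfin := fun k => finite_atomsColored (D := D) col {k}
  have hsub : atomsColored D col (c '' s) ⊆ ↑(s.biUnion fun a => (hfin (c a)).toFinset) := by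
    rintro A ⟨hA, hk⟩
    obtain ⟨a, ha, hca⟩ := hk ⟨0, hS.arity_pos _⟩
    simp only [Finset.coe_biUnion, Set.Finite.coe_toFinset, Set.mem_iUnion]
    exact ⟨a, ha, hA, fun i => (hD A hA _ _).trans hca.symm⟩
  refine (Set.ncard_le_ncard hsub (Finset.finite_toSet _)).trans ?_
  rw [Set.ncard_coe_finset]
  refine Finset.card_biUnion_le_card_mul _ _ _ fun a _ => ?_
  rw [← Set.ncard_eq_toFinset_card _ (hfin (c a))]
  refine le_trans ?_ (hg (c a))
  rw [← map_dom_image_atomsColored, Set.ncard_image_of_injective]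
  exact Atom.map_injective fun _ _ h => Const.dom.inj h

/-! ### Databases up to renaming of constants -/

theorem exists_injOn_fin {α : Type*} {X : Set α} (hX : X.Finite) {M : ℕ} (hM : X.ncard ≤ M) :
    ∃ ε : α → Fin (M + 1), Set.InjOn ε X := by
  classical
  have := hX.to_subtype
  have e : X ≃ Fin X.ncard := Finite.equivFinOfCardEq rfl
  refine ⟨fun a => if h : a ∈ X then Fin.castLE (hM.trans (Nat.le_succ M)) (e ⟨a, h⟩) else 0, ?_⟩
  intro a ha b hb hab
  simp only [dif_pos ha, dif_pos hb] at hab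
  exact congrArg Subtype.val (e.injective (Fin.castLE_injective _ hab))

/-- The constants of a query. -/
def queryConsts (q : ConjQuery R Dom Var) : Set Dom :=
  {c | ∃ A ∈ q.body, ∃ i, A.args i = .const c}

theorem finite_queryConsts (q : ConjQuery R Dom Var) : (queryConsts q).Finite := by
  have hinj : Function.Injective (Term.const : Dom → Term Dom Var) := fun _ _ h => Term.const.inj h
  have : (⋃ A ∈ q.body, Set.range A.args).Finite :=
    q.body.finite_toSet.biUnion fun A _ => Set.finite_range _
  refine (this.preimage hinj.injOn).subset ?_
  rintro c ⟨A, hA, i, hi⟩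
  simp only [Set.mem_preimage, Set.mem_iUnion]
  exact ⟨A, hA, i, hi⟩

/-- Databases with a tuple and the constants of a query, up to renaming of the constants. -/
abbrev Pattern (q : ConjQuery R Dom Var) (M : ℕ) : Type _ :=
  Set (Atom R (Fin (M + 1))) × (Fin q.arity → Fin (M + 1)) × (queryConsts q → Fin (M + 1))

/-- The pattern obtained by a renaming. -/
def pattern (q : ConjQuery R Dom Var) {M : ℕ} (ε : Dom → Fin (M + 1)) (B : Set (Atom R Dom))
    (t : Fin q.arity → Dom) : Pattern q M :=
  (Atom.map ε '' B, fun i => ε (t i), fun c => ε c)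

/-- `π` sends `d` to the constant with the same name under `ε₂`. Only `ε₂` need be injective, as a
homomorphism, not an isomorphism, is wanted. -/
theorem exists_renaming (q : ConjQuery R Dom Var) {M : ℕ} {ε₁ ε₂ : Dom → Fin (M + 1)}
    {B₁ B₂ : Set (Atom R Dom)} {t₁ t₂ : Fin q.arity → Dom}
    (h : pattern q ε₁ B₁ t₁ = pattern q ε₂ B₂ t₂)
    (hinj : Set.InjOn ε₂ (consts B₂ ∪ queryConsts q ∪ Set.range t₂)) :
    ∃ π : Dom → Dom, (∀ A ∈ B₁, A.map π ∈ B₂) ∧ (∀ i, π (t₁ i) = t₂ i) ∧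
      ∀ c ∈ queryConsts q, π c = c := by
  classical
  set X := consts B₂ ∪ queryConsts q ∪ Set.range t₂ with hX
  let π : Dom → Dom := fun d => if h : ∃ d' ∈ X, ε₂ d' = ε₁ d then h.choose else d
  have hπ : ∀ d, ∀ d' ∈ X, ε₂ d' = ε₁ d → π d = d' := by
    intro d d' hd' he
    have hex : ∃ d' ∈ X, ε₂ d' = ε₁ d := ⟨d', hd', he⟩
    simp only [π, dif_pos hex]
    exact hinj hex.choose_spec.1 hd' (hex.choose_spec.2.trans he.symm)
  simp only [pattern, Prod.mk.injEq] at h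
  obtain ⟨hB, ht, hc⟩ := h
  refine ⟨π, ?_, ?_, ?_⟩
  · rintro ⟨p, s⟩ hA
    have hmem : Atom.map ε₁ ⟨p, s⟩ ∈ Atom.map ε₂ '' B₂ := hB ▸ ⟨_, hA, rfl⟩
    obtain ⟨⟨p', s'⟩, hA', he⟩ := hmem
    simp only [Atom.map, Atom.mk.injEq] at he
    obtain ⟨rfl, he⟩ := he
    simp only [heq_eq_eq] at he
    have : (fun i => π (s i)) = s' :=
      funext fun i => hπ _ _ (.inl (.inl ⟨_, hA', i, rfl⟩)) (congrFun he i)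
    simpa only [Atom.map, this] using hA'
  · exact fun i => hπ _ _ (.inr ⟨i, rfl⟩) (congrFun ht i).symm
  · exact fun c hcq => hπ _ _ (.inl (.inr hcq)) (congrFun hc ⟨c, hcq⟩).symm

/-! ### Transfer from one representative of each pattern -/

/-- A pattern is realized at stage `n` if some run has a match of the query at that stage whose
facts have their colors in a set that induces this pattern. -/
def Realized (S : Deps R) (q : ConjQuery R Dom Var) {M : ℕ} (P : Pattern q M) (n : ℕ) : Prop :=
  ∃ (D : Finset (Atom R Dom)) (r : Run S D)
    (col : Const Dom → Option (joinGraph D).ConnectedComponent)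
    (K : Set (Option (joinGraph D).ConnectedComponent)) (μ : Var → Const Dom)
    (t : Fin q.arity → Dom) (ε : Dom → Fin (M + 1)),
    r.IsColoring col ∧
    (∀ A ∈ q.body, A.map (Term.value μ) ∈ (r.state n).facts ∧
      ∀ i, col ((A.map (Term.value μ)).args i) ∈ K) ∧
    (∀ i, μ (q.head i) = .dom (t i)) ∧ P = pattern q ε (atomsColored D col K) t

/-- A match of the query in a run yields a match of bounded level. -/
theorem exists_bound (hS : S.Tame) (q : ConjQuery R Dom Var) (g : ℕ) :
    ∃ L, ∀ (D : Finset (Atom R Dom)) (r : Run S D), largestComponent D = g →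
      ∀ (n : ℕ) (μ : Var → Const Dom) (t : Fin q.arity → Dom),
        (∀ A ∈ q.body, A.map (Term.value μ) ∈ (r.state n).facts) →
        (∀ i, μ (q.head i) = .dom (t i)) →
        ∃ μ' : Var → Const Dom, (∀ A ∈ q.body, A.map (Term.value μ') ∈ r.low L) ∧
          ∀ i, μ' (q.head i) = .dom (t i) := by
  classical
  have := hS.finite_pred
  obtain ⟨W, hW⟩ : ∃ W, ∀ p, R.arity p ≤ W := by
    obtain ⟨W, hW⟩ := (Set.finite_range R.arity).bddAbove
    exact ⟨W, fun p => hW ⟨p, rfl⟩⟩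
  have hQ := finite_queryConsts q
  have := hQ.to_subtype
  -- This bounds the constants to be named: those of at most `q.body.card * g` atoms with at most
  -- `W` arguments each, those of the query, and those of the answer.
  set M := q.body.card * g * W + (queryConsts q).ncard + q.arity with hM
  -- `N P` is a stage at which `P` is realized, with `0` as a default for patterns that never are.
  have hrep : ∀ P : Pattern q M, ∃ n, (∃ n, Realized S q P n) → Realized S q P n := by
    intro P
    by_cases h : ∃ n, Realized S q P n
    · exact ⟨h.choose, fun _ => h.choose_spec⟩
    · exact ⟨0, fun h' => (h h').elim⟩
  choose N hN using hrep
  obtain ⟨L, hL⟩ := (Set.finite_range fun P => transferBound S W g (N P)).bddAbove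
  refine ⟨L, fun D r hD n μ t hμ ht => ?_⟩
  have hmonoD : ∀ A ∈ D, ∀ i j, component D (.dom (A.args i)) = component D (.dom (A.args j)) :=
    fun A hA i j => (component_args hA i).trans (component_args hA j).symm
  obtain ⟨col, hcol₀, hcol⟩ := r.exists_coloring hS (component D) hmonoD
  have hg : ∀ k, (part (init D) col k).ncard ≤ g := fun k => hD ▸ ncard_part_init_le hS hcol₀ k
  -- The color of the fact to which a body atom is sent; only these colors matter for the match.
  let c : Atom R (Term Dom Var) → Option (joinGraph D).ConnectedComponent :=
    fun A => col ((A.map (Term.value μ)).args ⟨0, hS.arity_pos _⟩)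
  have hfin : (atomsColored D col (c '' q.body)).Finite := finite_atomsColored _ _
  have hcard : (atomsColored D col (c '' q.body)).ncard ≤ q.body.card * g :=
    ncard_atomsColored_le hS (fun A hA i j => by
      rw [hcol₀, hcol₀]
      exact hmonoD A hA i j) hg q.body c
  have htr : (Set.range t).ncard ≤ q.arity := by
    rw [← Set.image_univ]
    refine (Set.ncard_image_le (Set.toFinite _)).trans ?_
    simp [Set.ncard_univ]
  obtain ⟨ε, hε⟩ : ∃ ε : Dom → Fin (M + 1), Set.InjOn ε
      (consts (atomsColored D col (c '' q.body)) ∪ queryConsts q ∪ Set.range t) := by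
    refine exists_injOn_fin (((finite_consts hfin).union hQ).union (Set.finite_range t)) ?_
    refine (Set.ncard_union_le _ _).trans (add_le_add ((Set.ncard_union_le _ _).trans
      (Nat.add_le_add_right ?_ _)) htr)
    exact (ncard_consts_le_mul hW hfin).trans (Nat.mul_le_mul_right _ hcard)
  -- The representative has the same pattern as the given match, and its stage depends on that
  -- pattern alone.
  obtain ⟨D₁, r₁, col₁, K, μ₁, t₁, ε₁, hcol₁, hμ₁, ht₁, hP⟩ :=
    hN (pattern q ε (atomsColored D col (c '' q.body)) t)
      ⟨n, D, r, col, c '' q.body, μ, t, ε, hcol, fun A hA => ⟨hμ A hA, fun i =>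
        ⟨A, hA, hcol n _ (hμ A hA) _ _⟩⟩, ht, rfl⟩
  obtain ⟨π, hπ, hπt, hπq⟩ := exists_renaming q hP.symm hε
  obtain ⟨h, hdom, hh⟩ := r₁.exists_transfer hS hW hcol₁ K r hcol hg π
    (fun A hA hAK => (hπ A ⟨hA, hAK⟩).1) (N (pattern q ε (atomsColored D col (c '' q.body)) t))
  refine ⟨fun x => h (μ₁ x), fun A hA => ?_, fun i => ?_⟩
  · have he : A.map (Term.value fun x => h (μ₁ x)) = (A.map (Term.value μ₁)).map h := by
      rw [Atom.map_map]
      refine Atom.map_congr fun i => ?_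
      cases hi : A.args i with
      | const d => simp [Term.value, hdom, hπq d ⟨A, hA, i, hi⟩]
      | var x => rfl
    rw [he]
    exact r.low_mono (hL ⟨_, rfl⟩) (hh _ (hμ₁ A hA).1 (hμ₁ A hA).2)
  · simp only [ht₁, hdom, hπt]

end Chase

/-! ### Conceptual dependencies -/

namespace EERSchema

theorem finite_pred (C : EERSchema) : Finite C.relSchema.Pred := by
  have := C.finite_ent
  have := C.finite_rel
  have := C.finite_att
  refine Finite.of_surjective
    (Sum.elim PredSym.concept PredSym.att : (C.Ent ⊕ C.Rel) ⊕ C.Att → C.PredSym) ?_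
  rintro (X | A)
  · exact ⟨.inl X, rfl⟩
  · exact ⟨.inr A, rfl⟩

theorem finite_ids (C : EERSchema) : C.cds.ids.Finite := by
  have := C.finite_ent
  have := C.finite_rel
  have := C.finite_att
  refine Set.Finite.subset
    ((Set.finite_range fun A : C.Att =>
      (⟨C.att A, C.ownerPred A, _, C.attAttrs A, C.ownerAttrs A⟩ : InclDep C.relSchema)).union <|
    (Set.finite_range fun p : Σ R : C.Rel, Fin (C.relArity R) =>
      (⟨C.rel p.1, C.ent (C.among p.1 p.2), 1, C.relAttr p.1 p.2,
        C.entAttr (C.among p.1 p.2)⟩ : InclDep C.relSchema)).union <|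
    (Set.finite_range fun A : C.Att =>
      (⟨C.ownerPred A, C.att A, _, C.ownerAttrs A, C.attAttrs A⟩ : InclDep C.relSchema)).union <|
    (Set.finite_range fun p : C.Ent × C.Ent =>
      (⟨C.ent p.1, C.ent p.2, 1, C.entAttr p.1, C.entAttr p.2⟩ : InclDep C.relSchema)).union <|
    (Set.finite_range fun p : Σ R : C.Rel, Σ R' : C.Rel, Fin (C.relArity R) ≃ Fin (C.relArity R') =>
      (⟨C.rel p.1, C.rel p.2.1, C.relArity p.1,
        Function.Embedding.refl (Fin (C.relArity p.1)), p.2.2.toEmbedding⟩ :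
          InclDep C.relSchema)).union <|
    Set.finite_range fun p : C.Ent × Σ R : C.Rel, Fin (C.relArity R) =>
      (⟨C.ent p.1, C.rel p.2.1, 1, C.entAttr p.1, C.relAttr p.2.1 p.2.2⟩ :
        InclDep C.relSchema)) ?_
  rintro σ (A | ⟨R, i⟩ | A | ⟨E, E'⟩ | ⟨R, R', j⟩ | ⟨E, R, c⟩)
  · exact .inl ⟨A, rfl⟩
  · exact .inr (.inl ⟨⟨R, i⟩, rfl⟩)
  · exact .inr (.inr (.inl ⟨A, rfl⟩))
  · exact .inr (.inr (.inr (.inl ⟨(E, E'), rfl⟩)))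
  · exact .inr (.inr (.inr (.inr (.inl ⟨⟨R, R', j⟩, rfl⟩))))
  · exact .inr (.inr (.inr (.inr (.inr ⟨(E, ⟨R, c⟩), rfl⟩))))

theorem finite_kds (C : EERSchema) : C.cds.kds.Finite := by
  have := C.finite_rel
  have := C.finite_att
  refine Set.Finite.subset ((Set.finite_range C.attKey).union
    (Set.finite_range fun p : Σ R : C.Rel, Fin (C.relArity R) => C.relKey p.1 p.2)) ?_
  rintro κ (A | ⟨E, R, c⟩)
  · exact .inl ⟨A, rfl⟩
  · exact .inr ⟨⟨R, c⟩, rfl⟩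

theorem tame_cds (C : EERSchema) : C.cds.Tame where
  finite_pred := C.finite_pred
  arity_pos := by
    rintro (X | A)
    · exact C.conceptArity_pos X
    · exact Nat.succ_pos _
  finite_ids := C.finite_ids
  finite_kds := C.finite_kds
  width_pos := by
    rintro σ (A | ⟨R, i⟩ | A | ⟨E, E'⟩ | ⟨R, R', j⟩ | ⟨E, R, c⟩)
    · exact C.conceptArity_pos _
    · exact Nat.one_pos
    · exact C.conceptArity_pos _
    · exact Nat.one_pos
    · exact lt_of_lt_of_le Nat.two_pos (C.two_le_relArity R)
    · exact Nat.one_pos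

end EERSchema

/-! ### The main theorem -/

theorem mainTheorem2 (C : EERSchema) {Dom Var : Type*} (q : ConjQuery C.relSchema Dom Var) :
    ∃ δM : ℕ → ℕ,
      ∀ [LinearOrder (DBFact C.relSchema Dom)] [LinearOrder (InclDep C.relSchema)]
        [LinearOrder (KeyDep C.relSchema)] (D : Finset (Atom C.relSchema Dom)),
        Chase.Exists C.cds D →
          ∀ t ∈ q.freshFreeAnswers (Chase.chase C.cds D),
            ∃ μ : Var → Const Dom, q.IsWitness (Chase.chase C.cds D) t μ ∧
              ∀ A ∈ q.body, A.map (Term.value μ) ∈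
                Chase.firstLevels C.cds D (δM (largestComponent D)) := by
  choose δM hδ using Chase.exists_bound C.tame_cds q
  refine ⟨δM, ?_⟩
  intro _ _ _ D hD t ht
  obtain ⟨⟨μ, hμ, hhead⟩, hfree⟩ := ht
  choose t' ht' using hfree
  obtain ⟨r, hr⟩ := hD.run C.tame_cds
  -- The body is finite, so all facts of the match are present together at some stage.
  obtain ⟨n, hn⟩ := ((Filter.eventually_all_finset q.body).2 hμ).exists
  obtain ⟨μ', h₁, h₂⟩ := hδ _ D r rfl n μ t' (fun A hA => by
    obtain ⟨I, hI, hmem⟩ := hn A hA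
    rw [hr] at hI
    cases hI
    exact hmem) (fun i => (hhead i).trans (ht' i))
  refine ⟨μ', ⟨fun A hA => ?_, fun i => (h₂ i).trans (ht' i).symm⟩,
    fun A hA => r.mem_firstLevels hr (h₁ A hA)⟩
  obtain ⟨N, hN⟩ := h₁ A hA
  exact Filter.eventually_atTop.2 ⟨N, fun m hm => ⟨_, hr m, (hN m hm).1⟩⟩
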